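/- Let $\mathcal R=\mathbb R^3$ carry the form $x^2+y^2-z^2$, identified with $-\det$ on $\mathfrak{sl}_2(\mathbb R)$ via $(x,y,z)\mapsto\begin{pmatrix}x&y+z\\y-z&-x\end{pmatrix}$. Let $G=PSL_2(\mathbb R)\ltimes\mathbb R^3$ (adjoint action) act on $\mathcal R$ by $p\mapsto \gamma p\gamma^{-1}+v$, let $\Gamma\cong PSL_2(\mathbb R)$ be the stabilizer of $0$ in $G$, and let $\Psi$ be the manifold of euclidean planes, i.e. of affine planes $X\subset\mathcal R$ on whose direction the form is positive definite (equivalently $X=\{z=ax+by+c\}$ with $a^2+b^2<1$; $(a,b,c)$ is a global chart of the $3$-dimensional manifold $\Psi$). $G$ acts on $\Psi$. Let $P\in\Psi$ be a plane through $0$ and $L(P)$ the line through $0$ orthogonal to $P$ with respect to the form. Let $\Sigma\subset\Gamma$ be the image of the section of the hyperbolic plane loop whose identity is the point at infinity of $L(P)$: for $P_0=\{z=0\}$ it is the set of classes in $PSL_2(\mathbb R)$ of symmetric positive definite matrices of determinant $1$, and for $P=\gamma P_0$, $\gamma\in\Gamma$, it is the conjugate of this set by $\gamma$. A line $S$ through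 $0$ is called admissible if it meets every plane of $\Psi$ in precisely one point; for such $S$ let $\Lambda=\Lambda_S$ be the group of translations by vectors of $S$ and $\Theta=\Lambda\Sigma\subset G$. (1) For every admissible $S$ the set $\Theta$ acts sharply transitively on $\Psi$: for all $D_1,D_2\in\Psi$ there is exactly one $\rho\in\Theta$ with $\rho(D_1)=D_2$. (2) Consequently, for every $Q\in\Psi$, the multiplication $X*Y=\rho(Y)$, where $\rho\in\Theta$ is the element with $\rho(Q)=X$, makes $\Psi$ a $3$-dimensional differentiable ($C^\infty$) loop with identity $Q$: multiplication and both divisions are smooth. $G$ acts faithfully on $\Psi$ by homeomorphisms, $\Theta$ is the set of left translations of the loop, and $G$ is the group generated, and also the group topologically generated (in the homeomorphism group of $\Psi$ with the compact-open topology), by the left translations. (3) None of these loops is a Bol loop (a loop is Bol if $\lambda_a\lambda_b\lambda_a$ is a left translation for all left translations $\lambda_a,\lambda_b$). Let $L_\Lambda$ denote the loop of (2) with identity $Q=P$, and let $K=\{\gamma\in\Gamma:\gamma P=P\}$. (4) The line $L(P)$ is admissible, and $K$ acts on $L_{\Lambda_{L(P)}}$ as a $1$-dimensional compact group of automorphisms: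 its elements are automorphisms, and there is an isomorphism of the circle group onto the group of transformations of $\Psi$ induced by $K$ for which the resulting action of the circle on $\Psi$ is faithful and smooth. (5) If $S\neq L(P)$ is admissible, then $L_{\Lambda_S}$ is not isomorphic to $L_{\Lambda_{L(P)}}$ (not even as an abstract loop). If $S$ is admissible and $\gamma\in K$, then $\gamma S$ is admissible and $L_{\Lambda_{\gamma S}}$ is isomorphic to $L_{\Lambda_S}$. -/

import Mathlib

open scoped Manifold ContDiff MatrixGroups

/-! ### Loops -/

namespace LoopTheory

/-- `mul` is a loop multiplication with identity `e`. -/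
structure IsLoop {L : Type*} (mul : L → L → L) (e : L) : Prop where
  one_mul : ∀ x, mul e x = x
  mul_one : ∀ x, mul x e = x
  existsUnique_left : ∀ a b, ∃! y, mul a y = b
  existsUnique_right : ∀ a b, ∃! x, mul x a = b

/-- A differentiable (`C^∞`) loop: multiplication and both divisions are smooth. -/
structure IsDifferentiableLoop {E H L : Type*} [NormedAddCommGroup E] [NormedSpace ℝ E]
    [TopologicalSpace H] (I : ModelWithCorners ℝ E H) [TopologicalSpace L] [ChartedSpace H L]
    (mul : L → L → L) (e : L) : Prop where
  isLoop : IsLoop mul e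
  smooth_mul : ContMDiff (I.prod I) I ∞ (fun p : L × L => mul p.1 p.2)
  smooth_ldiv : ∃ ldiv : L → L → L, (∀ a b, mul a (ldiv a b) = b) ∧
    ContMDiff (I.prod I) I ∞ (fun p : L × L => ldiv p.1 p.2)
  smooth_rdiv : ∃ rdiv : L → L → L, (∀ a b, mul (rdiv b a) a = b) ∧
    ContMDiff (I.prod I) I ∞ (fun p : L × L => rdiv p.1 p.2)

/-- Bol loops: `λ_a λ_b λ_a` is a left translation for all left translations `λ_a`, `λ_b`. -/
def IsBol {L : Type*} (mul : L → L → L) : Prop :=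
  ∀ a b, ∃ c, ∀ y, mul a (mul b (mul a y)) = mul c y

/-- Isomorphisms of loops: bijections compatible with the multiplications. -/
def IsIsomorphism {L L' : Type*} (mul : L → L → L) (mul' : L' → L' → L') (f : L ≃ L') : Prop :=
  ∀ x y, f (mul x y) = mul' (f x) (f y)

def Isomorphic {L L' : Type*} (mul : L → L → L) (mul' : L' → L' → L') : Prop :=
  ∃ f : L ≃ L', IsIsomorphism mul mul' f

/-- The left translations `λ_a : y ↦ a · y`, as homeomorphisms. -/
def leftTranslations {L : Type*} [TopologicalSpace L] (mul : L → L → L) : Set (L ≃ₜ L) :=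
  {f | ∃ a, ∀ y, f y = mul a y}

/-- The homeomorphisms in the closure, for the compact-open topology (the topology of `C(L, L)`),
of the group generated by `S`. -/
def topologicallyGenerated {L : Type*} [TopologicalSpace L] (S : Set (L ≃ₜ L)) : Set (L ≃ₜ L) :=
  {f | (f : C(L, L)) ∈
    closure ((fun g : L ≃ₜ L => (g : C(L, L))) '' (Subgroup.closure S : Set (L ≃ₜ L)))}

end LoopTheory

/-! ### The pseudo-euclidean space and its group of motions -/

namespace PseudoEuclid

/-- The points `(x, y, z)` of the pseudo-euclidean space. -/
abbrev V : Type := Fin 3 → ℝ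

/-- The form `x x' + y y' - z z'`. -/
noncomputable def form : LinearMap.BilinForm ℝ V :=
  LinearMap.mk₂ ℝ (fun v w => v 0 * w 0 + v 1 * w 1 - v 2 * w 2)
    (by intros; simp; ring) (by intros; simp; ring) (by intros; simp; ring) (by intros; simp; ring)

theorem form_apply (v w : V) : form v w = v 0 * w 0 + v 1 * w 1 - v 2 * w 2 := rfl

/-- The identification of `ℝ³` with the trace zero matrices, `(x, y, z) ↦ [[x, y+z], [y-z, -x]]`.
Under it `x² + y² - z²` becomes `-det`. -/
def toMat (v : V) : Matrix (Fin 2) (Fin 2) ℝ := !![v 0, v 1 + v 2; v 1 - v 2, -v 0]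

/-- The inverse of `toMat` on trace zero matrices. -/
noncomputable def ofMat (M : Matrix (Fin 2) (Fin 2) ℝ) : V :=
  ![M 0 0, (M 0 1 + M 1 0) / 2, (M 0 1 - M 1 0) / 2]

theorem toMat_ofMat (M : Matrix (Fin 2) (Fin 2) ℝ) (h : M.trace = 0) : toMat (ofMat M) = M := by
  rw [Matrix.trace_fin_two] at h
  ext i j
  fin_cases i <;> fin_cases j <;> simp [toMat, ofMat] <;> linarith

theorem ofMat_toMat (v : V) : ofMat (toMat v) = v := by
  ext i
  fin_cases i <;> simp [toMat, ofMat]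

theorem trace_toMat (v : V) : (toMat v).trace = 0 := by
  simp [Matrix.trace_fin_two, toMat]

theorem form_self (v : V) : form v v = -(toMat v).det := by
  simp [form_apply, toMat, Matrix.det_fin_two]; ring

theorem toMat_add (v w : V) : toMat (v + w) = toMat v + toMat w := by
  ext i j
  fin_cases i <;> fin_cases j <;> simp [toMat] <;> ring

theorem toMat_smul (c : ℝ) (v : V) : toMat (c • v) = c • toMat v := by
  ext i j
  fin_cases i <;> fin_cases j <;> simp [toMat] <;> ring

theorem ofMat_add (M N : Matrix (Fin 2) (Fin 2) ℝ) : ofMat (M + N) = ofMat M + ofMat N := by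
  ext i
  fin_cases i <;> simp [ofMat] <;> ring

theorem ofMat_smul (c : ℝ) (M : Matrix (Fin 2) (Fin 2) ℝ) : ofMat (c • M) = c • ofMat M := by
  ext i
  fin_cases i <;> simp [ofMat] <;> ring

theorem trace_conj (A : SL(2, ℝ)) (M : Matrix (Fin 2) (Fin 2) ℝ) (h : M.trace = 0) :
    ((A : Matrix (Fin 2) (Fin 2) ℝ) * M * ((A⁻¹ : SL(2, ℝ)) : Matrix (Fin 2) (Fin 2) ℝ)).trace
      = 0 := by
  rw [Matrix.trace_mul_comm, ← Matrix.mul_assoc, ← Matrix.SpecialLinearGroup.coe_mul]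
  simpa using h

/-- The adjoint action `Y ↦ A Y A⁻¹` of `SL₂(ℝ)` on `ℝ³ ≅ 𝔰𝔩₂(ℝ)`. -/
noncomputable def adSL : SL(2, ℝ) →* (V →ₗ[ℝ] V) where
  toFun A :=
    { toFun := fun v => ofMat ((A : Matrix (Fin 2) (Fin 2) ℝ) * toMat v *
        ((A⁻¹ : SL(2, ℝ)) : Matrix (Fin 2) (Fin 2) ℝ))
      map_add' := fun v w => by rw [toMat_add, Matrix.mul_add, Matrix.add_mul, ofMat_add]
      map_smul' := fun c v => by
        rw [toMat_smul, Matrix.mul_smul, Matrix.smul_mul, ofMat_smul, RingHom.id_apply] }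
  map_one' := by
    refine LinearMap.ext fun v => ?_
    simp [ofMat_toMat]
  map_mul' A B := by
    refine LinearMap.ext fun v => ?_
    change ofMat _ = ofMat (_ * toMat (ofMat _) * _)
    rw [toMat_ofMat _ (trace_conj B _ (trace_toMat v)), mul_inv_rev,
      Matrix.SpecialLinearGroup.coe_mul, Matrix.SpecialLinearGroup.coe_mul]
    simp only [Matrix.mul_assoc]

theorem adSL_apply (A : SL(2, ℝ)) (v : V) :
    adSL A v = ofMat ((A : Matrix (Fin 2) (Fin 2) ℝ) * toMat v *
        ((A⁻¹ : SL(2, ℝ)) : Matrix (Fin 2) (Fin 2) ℝ)) := rfl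

theorem form_adSL (A : SL(2, ℝ)) (v : V) : form (adSL A v) (adSL A v) = form v v := by
  rw [form_self, form_self, adSL_apply, toMat_ofMat _ (trace_conj A _ (trace_toMat v)),
    Matrix.det_mul, Matrix.det_mul, Matrix.SpecialLinearGroup.det_coe,
    Matrix.SpecialLinearGroup.det_coe, one_mul, mul_one]

/-- `PSL₂(ℝ)`. -/
abbrev PSL2 : Type := Matrix.ProjectiveSpecialLinearGroup (Fin 2) ℝ

theorem center_le_ker :
    Subgroup.center SL(2, ℝ) ≤ adSL.toHomUnits.ker := by
  intro A hA
  rw [MonoidHom.mem_ker, Units.ext_iff]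
  refine LinearMap.ext fun v => ?_
  change adSL A v = v
  obtain ⟨r, -, hs⟩ := Matrix.SpecialLinearGroup.mem_center_iff.1 hA
  have hc : (A : Matrix (Fin 2) (Fin 2) ℝ) * toMat v = toMat v * A := by
    rw [← hs]; exact (Matrix.scalar_commute r (fun _ => mul_comm _ _) _)
  rw [adSL_apply, hc, Matrix.mul_assoc, ← Matrix.SpecialLinearGroup.coe_mul]
  simp [ofMat_toMat]

/-- The adjoint action of `PSL₂(ℝ)` on `ℝ³ ≅ 𝔰𝔩₂(ℝ)`. -/
noncomputable def ad : PSL2 →* (V ≃ₗ[ℝ] V) :=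
  (LinearMap.GeneralLinearGroup.generalLinearEquiv ℝ V).toMonoidHom.comp
    (QuotientGroup.lift _ adSL.toHomUnits center_le_ker)

theorem ad_mk (A : SL(2, ℝ)) (v : V) : ad (QuotientGroup.mk A) v = adSL A v := rfl

/-- The same action, by automorphisms of the translation group `ℝ³` (written multiplicatively). -/
noncomputable def adAut : PSL2 →* MulAut (Multiplicative V) where
  toFun γ := AddEquiv.toMultiplicative (ad γ).toAddEquiv
  map_one' := by ext1 v; simp
  map_mul' γ δ := by ext1 v; simp

/-- The semidirect product `PSL₂(ℝ) ⋉ ℝ³` for the adjoint action. -/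
abbrev G : Type := Multiplicative V ⋊[adAut] PSL2

/-- `ℝ³` as the group of translations in `G`. -/
noncomputable def transl (v : V) : G := SemidirectProduct.inl (Multiplicative.ofAdd v)

/-- The stabilizer `Γ ≅ PSL₂(ℝ)` of the origin in `G`. -/
noncomputable def rot (γ : PSL2) : G := SemidirectProduct.inr γ

/-- The action of `G` on the affine space: `(v, γ)` sends `p` to `γ p + v`. -/
noncomputable def motion (g : G) : V ≃ᵃ[ℝ] V :=
  (ad g.right).toAffineEquiv.trans (AffineEquiv.constVAdd ℝ V (Multiplicative.toAdd g.left))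

theorem motion_apply (g : G) (p : V) :
    motion g p = ad g.right p + Multiplicative.toAdd g.left := by
  simp [motion, add_comm]

theorem motion_one : motion 1 = AffineEquiv.refl ℝ V := by
  ext1 p
  simp [motion_apply]

theorem motion_mul (g h : G) : motion (g * h) = (motion h).trans (motion g) := by
  refine AffineEquiv.ext fun p => ?_
  rw [AffineEquiv.trans_apply, motion_apply, motion_apply, motion_apply, SemidirectProduct.mul_left,
    SemidirectProduct.mul_right, map_mul, map_add]
  change ad g.right (ad h.right p) +
    (Multiplicative.toAdd g.left + ad g.right (Multiplicative.toAdd h.left)) = _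
  abel

theorem form_ad (γ : PSL2) (v : V) : form (ad γ v) (ad γ v) = form v v := by
  induction γ using QuotientGroup.induction_on with
  | H A => exact form_adSL A v

/-! ### The manifold of euclidean planes -/

/-- The affine planes on which the form is positive definite, i.e. whose line at infinity consists
of points `(0 : x : y : z)` with `x² + y² > z²`. -/
def IsEuclideanPlane (X : AffineSubspace ℝ V) : Prop :=
  (X : Set V).Nonempty ∧ Module.finrank ℝ X.direction = 2 ∧ ∀ v ∈ X.direction, v ≠ 0 → 0 < form v v

/-- The set `Ψ` of euclidean planes. -/
def Psi : Type := {X : AffineSubspace ℝ V // IsEuclideanPlane X}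

theorem isEuclideanPlane_map (g : G) (X : AffineSubspace ℝ V) (hX : IsEuclideanPlane X) :
    IsEuclideanPlane (X.map (motion g).toAffineMap) := by
  have hl : ∀ v, (motion g).toAffineMap.linear v = ad g.right v := fun v => rfl
  refine ⟨by simpa using hX.1, ?_, ?_⟩
  · rw [AffineSubspace.map_direction, ← hX.2.1]
    exact LinearEquiv.finrank_map_eq (ad g.right) X.direction
  · intro v hv hv0
    rw [AffineSubspace.map_direction, Submodule.mem_map] at hv
    obtain ⟨w, hw, rfl⟩ := hv
    rw [hl, form_ad]
    refine hX.2.2 w hw ?_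
    rintro rfl
    exact hv0 (map_zero _)

/-- The action of `G` on `Ψ`. -/
noncomputable instance : MulAction G Psi where
  smul g X := ⟨X.1.map (motion g).toAffineMap, isEuclideanPlane_map g X.1 X.2⟩
  one_smul X := by
    refine Subtype.ext ?_
    change X.1.map (motion 1).toAffineMap = X.1
    rw [motion_one]
    exact AffineSubspace.map_id X.1
  mul_smul g h X := by
    refine Subtype.ext ?_
    change X.1.map (motion (g * h)).toAffineMap
      = (X.1.map (motion h).toAffineMap).map (motion g).toAffineMap
    rw [AffineSubspace.map_map, motion_mul]
    rfl

theorem mem_smul_iff (g : G) (X : Psi) (p : V) : motion g p ∈ (g • X).1 ↔ p ∈ X.1 :=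
  AffineSubspace.mem_map_iff_mem_of_injective (motion g).injective

/-- The plane `z = a x + b y + c`. -/
def graph (a b c : ℝ) : AffineSubspace ℝ V where
  carrier := {p | p 2 = a * p 0 + b * p 1 + c}
  smul_vsub_vadd_mem' := by
    intro t p q r hp hq hr
    simp only [Set.mem_ofPred_eq, vsub_eq_sub, vadd_eq_add, Pi.add_apply, Pi.smul_apply,
      Pi.sub_apply, smul_eq_mul] at *
    rw [hp, hq, hr]; ring

theorem mem_graph {a b c : ℝ} {p : V} : p ∈ graph a b c ↔ p 2 = a * p 0 + b * p 1 + c := Iff.rfl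

theorem mem_direction_graph {a b c : ℝ} {v : V} :
    v ∈ (graph a b c).direction ↔ v 2 = a * v 0 + b * v 1 := by
  have h0 : (![0, 0, c] : V) ∈ graph a b c := by simp [mem_graph]
  rw [← AffineSubspace.vadd_mem_iff_mem_direction v h0, mem_graph]
  simp only [vadd_eq_add, Pi.add_apply]
  constructor <;> intro h <;> simp at h ⊢ <;> linarith

theorem isEuclideanPlane_graph {a b c : ℝ} (h : a ^ 2 + b ^ 2 < 1) :
    IsEuclideanPlane (graph a b c) := by
  refine ⟨⟨![0, 0, c], show _ ∈ graph a b c by simp [mem_graph]⟩, ?_, ?_⟩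
  · let e : (graph a b c).direction ≃ₗ[ℝ] (Fin 2 → ℝ) :=
      { toFun := fun v => ![v.1 0, v.1 1]
        map_add' := by intro v w; ext i; fin_cases i <;> simp
        map_smul' := by intro t v; ext i; fin_cases i <;> simp
        invFun := fun w => ⟨![w 0, w 1, a * w 0 + b * w 1], by simp [mem_direction_graph]⟩
        left_inv := by
          rintro ⟨v, hv⟩
          rw [mem_direction_graph] at hv
          refine Subtype.ext (funext fun i => ?_)
          fin_cases i <;> simp [hv]
        right_inv := by intro w; ext i; fin_cases i <;> simp }
    rw [e.finrank_eq]; simp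
  · intro v hv hv0
    rw [mem_direction_graph] at hv
    rw [form_apply, hv]
    have hxy : 0 < v 0 * v 0 + v 1 * v 1 := by
      by_contra hn
      have h0 : v 0 = 0 := by nlinarith [mul_self_nonneg (v 0), mul_self_nonneg (v 1)]
      have h1 : v 1 = 0 := by nlinarith [mul_self_nonneg (v 0), mul_self_nonneg (v 1)]
      refine hv0 (funext fun i => ?_)
      fin_cases i <;> simp [h0, h1, hv]
    nlinarith [sq_nonneg (a * v 1 - b * v 0), mul_pos (sub_pos.2 h) hxy]

/-- The parameters `(a, b, c)` of the planes `z = a x + b y + c` in `Ψ`. -/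
def coordDomain : Set (EuclideanSpace ℝ (Fin 3)) := {w | w 0 ^ 2 + w 1 ^ 2 < 1}

def ofCoord (w : coordDomain) : Psi := ⟨graph (w.1 0) (w.1 1) (w.1 2), isEuclideanPlane_graph w.2⟩

theorem ofCoord_injective : Function.Injective ofCoord := by
  intro w w' h
  have h' : ∀ p : V, p ∈ graph (w.1 0) (w.1 1) (w.1 2) ↔ p ∈ graph (w'.1 0) (w'.1 1) (w'.1 2) := by
    intro p
    have := congrArg (fun X : Psi => p ∈ X.1) h
    exact iff_of_eq this
  have h2 : w.1 2 = w'.1 2 := by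
    simpa [mem_graph] using (h' ![0, 0, w.1 2]).1 (by simp [mem_graph])
  have h0 : w.1 0 = w'.1 0 := by
    have := (h' ![1, 0, w.1 0 + w.1 2]).1 (by simp [mem_graph])
    simp [mem_graph] at this
    linarith
  have h1 : w.1 1 = w'.1 1 := by
    have := (h' ![0, 1, w.1 1 + w.1 2]).1 (by simp [mem_graph])
    simp [mem_graph] at this
    linarith
  refine Subtype.ext (PiLp.ext fun i => ?_)
  fin_cases i
  exacts [h0, h1, h2]

theorem ofCoord_surjective : Function.Surjective ofCoord := by
  rintro ⟨X, ⟨p, hp⟩, hd, hX⟩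
  let π : X.direction →ₗ[ℝ] (Fin 2 → ℝ) :=
    { toFun := fun v => ![v.1 0, v.1 1]
      map_add' := by intro v w; ext i; fin_cases i <;> simp
      map_smul' := by intro t v; ext i; fin_cases i <;> simp }
  have hinj : Function.Injective π := by
    rw [← LinearMap.ker_eq_bot, LinearMap.ker_eq_bot']
    rintro ⟨v, hv⟩ h
    have h0 : v 0 = 0 := congrFun h 0
    have h1 : v 1 = 0 := congrFun h 1
    by_contra hne
    have := hX v hv (fun h => hne (Subtype.ext h))
    rw [form_apply, h0, h1] at this
    nlinarith [mul_self_nonneg (v 2)]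
  have hsurj : Function.Surjective π :=
    (LinearMap.injective_iff_surjective_of_finrank_eq_finrank (by simp [hd])).1 hinj
  obtain ⟨⟨u, hu⟩, hu'⟩ := hsurj ![1, 0]
  obtain ⟨⟨v, hv⟩, hv'⟩ := hsurj ![0, 1]
  have u0 : u 0 = 1 := congrFun hu' 0
  have u1 : u 1 = 0 := congrFun hu' 1
  have v0 : v 0 = 0 := congrFun hv' 0
  have v1 : v 1 = 1 := congrFun hv' 1
  have key : ∀ d ∈ X.direction, d 2 = u 2 * d 0 + v 2 * d 1 := by
    intro d hd
    have hz : (⟨d, hd⟩ : X.direction) = d 0 • ⟨u, hu⟩ + d 1 • ⟨v, hv⟩ := by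
      apply hinj
      rw [map_add, map_smul, map_smul, hu', hv']
      ext i
      fin_cases i <;> simp [π]
    have := congrFun (congrArg Subtype.val hz) 2
    simp at this
    linarith
  have hlt : u 2 ^ 2 + v 2 ^ 2 < 1 := by
    by_cases h0 : u 2 ^ 2 + v 2 ^ 2 = 0
    · rw [h0]; exact one_pos
    · have hd' : u 2 • u + v 2 • v ∈ X.direction :=
        X.direction.add_mem (X.direction.smul_mem _ hu) (X.direction.smul_mem _ hv)
      have hpos : 0 < u 2 ^ 2 + v 2 ^ 2 := lt_of_le_of_ne (by positivity) (Ne.symm h0)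
      have := hX _ hd' (by
        intro h
        have := congrFun h 2
        simp at this
        exact h0 (by linarith))
      simp [form_apply, u0, u1, v0, v1] at this
      nlinarith
  refine ⟨⟨!₂[u 2, v 2, p 2 - u 2 * p 0 - v 2 * p 1], by simpa [coordDomain] using hlt⟩, ?_⟩
  refine Subtype.ext ?_
  have hpg : p ∈ graph (u 2) (v 2) (p 2 - u 2 * p 0 - v 2 * p 1) := by
    rw [mem_graph]; ring
  have hle : X.direction ≤ (graph (u 2) (v 2) (p 2 - u 2 * p 0 - v 2 * p 1)).direction :=
    fun d hd => mem_direction_graph.2 (key d hd)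
  have heq : X.direction = (graph (u 2) (v 2) (p 2 - u 2 * p 0 - v 2 * p 1)).direction :=
    Submodule.eq_of_le_of_finrank_eq hle (by rw [hd, (isEuclideanPlane_graph hlt).2.1])
  exact (AffineSubspace.ext_of_direction_eq heq ⟨p, hp, hpg⟩).symm

/-- The coordinates `(a, b, c)` of the plane `z = a x + b y + c`. -/
noncomputable def coord (X : Psi) : EuclideanSpace ℝ (Fin 3) :=
  ((Equiv.ofBijective ofCoord ⟨ofCoord_injective, ofCoord_surjective⟩).symm X).1

theorem coord_ofCoord (w : coordDomain) : coord (ofCoord w) = w.1 := by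
  rw [coord]
  exact congrArg Subtype.val (Equiv.ofBijective_symm_apply_apply ofCoord _ w)

theorem mem_iff_coord (X : Psi) (p : V) :
    p ∈ X.1 ↔ p 2 = coord X 0 * p 0 + coord X 1 * p 1 + coord X 2 := by
  obtain ⟨w, rfl⟩ := ofCoord_surjective X
  rw [coord_ofCoord]
  exact Iff.rfl

theorem coord_injective : Function.Injective coord :=
  Subtype.val_injective.comp (Equiv.injective _)

theorem range_coord : Set.range coord = coordDomain := by
  unfold coord
  rw [show (fun X : Psi => ((Equiv.ofBijective ofCoord
    ⟨ofCoord_injective, ofCoord_surjective⟩).symm X).1) = Subtype.val ∘ (Equiv.ofBijective ofCoord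
    ⟨ofCoord_injective, ofCoord_surjective⟩).symm from rfl, Set.range_comp, Equiv.range_eq_univ,
    Set.image_univ, Subtype.range_coe]

/-- The topology and (below) the smooth structure of `Ψ` for which `coord` is a diffeomorphism onto
the open set `a² + b² < 1` of `ℝ³`. -/
noncomputable instance : TopologicalSpace Psi := TopologicalSpace.induced coord inferInstance

theorem isOpenEmbedding_coord : Topology.IsOpenEmbedding coord where
  eq_induced := rfl
  injective := coord_injective
  isOpen_range := by
    rw [range_coord]
    exact isOpen_lt (by fun_prop) continuous_const

/-- The plane `z = 0`. -/
def basePlane : Psi := ⟨graph 0 0 0, isEuclideanPlane_graph (by norm_num)⟩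

instance : Nonempty Psi := ⟨basePlane⟩

noncomputable instance : ChartedSpace (EuclideanSpace ℝ (Fin 3)) Psi :=
  isOpenEmbedding_coord.singletonChartedSpace

instance : IsManifold (𝓡 3) ∞ Psi :=
  isOpenEmbedding_coord.isManifold_singleton

/-! ### The sections `Λ Σ` and their loops -/

/-- The image of the section of the hyperbolic plane loop for the standard base point (the point at
infinity of the `z`-axis): the hyperbolic translations moving this point, i.e. the elements of
`PSL₂(ℝ)` represented by positive definite symmetric matrices of determinant `1`. -/
def hypSectionStd : Set PSL2 :=
  {γ | ∃ A : SL(2, ℝ), (A : Matrix (Fin 2) (Fin 2) ℝ).PosDef ∧ QuotientGroup.mk A = γ}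

/-- The image `Σ ⊆ Γ` of the section of the hyperbolic plane loop whose identity is the pole of the
line at infinity of the plane `P` through the origin. (It does not depend on the motion `γ` carrying
the standard base plane to `P`.) -/
def hypSection (P : Psi) : Set G :=
  {σ | ∃ γ : PSL2, rot γ • basePlane = P ∧ ∃ δ ∈ hypSectionStd, σ = rot (γ * δ * γ⁻¹)}

/-- `W` is a line `S` through the origin that intersects any plane of `Ψ` in precisely one point. -/
def IsTransversal (W : Submodule ℝ V) : Prop :=
  Module.finrank ℝ W = 1 ∧ ∀ X : Psi, ∃! p, p ∈ W ∧ p ∈ X.1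

/-- The `1`-dimensional translation group `Λ` leaving the line `W` through the origin invariant. -/
def translations (W : Submodule ℝ V) : Set G := {τ | ∃ w ∈ W, τ = transl w}

/-- The product `Θ = Λ Σ`. -/
def theta (P : Psi) (W : Submodule ℝ V) : Set G :=
  {ρ | ∃ τ ∈ translations W, ∃ σ ∈ hypSection P, ρ = τ * σ}

/-- The multiplication `X * Y = ρ(Y)` on `Ψ`, where `ρ ∈ Θ` is the element mapping the identity `Q`
to `X`. -/
noncomputable def loopMul (Θ : Set G) (Q X Y : Psi) : Psi :=
  Classical.epsilon (fun ρ : G => ρ ∈ Θ ∧ ρ • Q = X) • Y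

/-- The line `L(P)` joining the origin with the pole of the line at infinity of `P`: the orthogonal
complement of the direction of `P`. -/
noncomputable def polarLine (P : Psi) : Submodule ℝ V := form.orthogonal P.1.direction

end PseudoEuclid

open LoopTheory PseudoEuclid

/-! A euclidean plane is determined by its unit normal `n`, a point of the upper sheet of `form n n
= -1`, and a real height `k`: it is the set of `p` with `form n p + k = 0`. This makes `Ψ` a product
of the hyperbolic plane and a line, on which `p ↦ γ p + v` acts by `n ↦ γ n` and `k ↦ k - form (γ n)
v`. Every assertion is read off in these coordinates. Conjugation by an element of `Γ` reduces
nearly all of them to the plane `z = 0`.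

Sharp transitivity: exactly one positive definite symmetric matrix of determinant 1 carries a given
normal to another one (`ad_hypMove`, `eq_hypMove`). A translation by `s • w` then changes the height
by `-s * form n w`, and admissibility of the line spanned by `w` says that `form n w` never vanishes
(`isTransversal_iff`), so `s` is unique. The solution is given by explicit formulas, whence the loop
and both its divisions are smooth.

Generation: positive definite matrices generate `PSL₂(ℝ)`, and the conjugates of one admissible line
of translations generate `ℝ³`. Nothing is added by passing to the closure, because the
transformations from `G` are characterized by identities that survive pointwise limits
(`IsMotionLike`). The Bol identity fails because it would force `Σ` to leave the line `S` invariant.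

Isomorphisms: a loop isomorphism conjugates left translations to left translations, so it induces an
injective endomorphism `α` of `G` preserving the stabilizer of `P`. In that stabilizer the
translations along `P` are commutators, while its rotation parts commute; hence `α` maps
translations to translations (`map_transl_right`). If the target line is `L(P)`, its translations
commute with the rotations in `K`, up to translations. Pulling this back through `α` shows that the
half turn about `L(P)` fixes `S` pointwise, so `S = L(P)`. -/

namespace PseudoEuclid

/-! ### The adjoint representation in coordinates -/

/-- The matrix `[[a, b], [c, d]]` as an element of `SL₂(ℝ)`. -/
def slMk (a b c d : ℝ) (h : a * d - b * c = 1) : SL(2, ℝ) :=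
  ⟨!![a, b; c, d], by rw [Matrix.det_fin_two_of, h]⟩

theorem exists_slMk (A : SL(2, ℝ)) : ∃ a b c d h, A = slMk a b c d h := by
  have h := A.2
  rw [Matrix.det_fin_two] at h
  refine ⟨_, _, _, _, h, Subtype.ext ?_⟩
  exact Matrix.eta_fin_two _

theorem slMk_mul {a b c d a' b' c' d' : ℝ} (h : a * d - b * c = 1) (h' : a' * d' - b' * c' = 1) :
    slMk a b c d h * slMk a' b' c' d' h' =
      slMk (a * a' + b * c') (a * b' + b * d') (c * a' + d * c') (c * b' + d * d')
        (by linear_combination (a' * d' - b' * c') * h + h') := by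
  exact Subtype.ext ((Matrix.SpecialLinearGroup.coe_mul _ _).trans (Matrix.mul_fin_two ..))

theorem slMk_inv {a b c d : ℝ} (h : a * d - b * c = 1) :
    (slMk a b c d h)⁻¹ = slMk d (-b) (-c) a (by linear_combination h) := by
  refine Subtype.ext ?_
  rw [Matrix.SpecialLinearGroup.coe_inv]
  simp [slMk, Matrix.adjugate_fin_two]

theorem slMk_congr {a b c d a' b' c' d' : ℝ} (h : a * d - b * c = 1) (h' : a' * d' - b' * c' = 1)
    (ha : a = a') (hb : b = b') (hc : c = c') (hd : d = d') :
    slMk a b c d h = slMk a' b' c' d' h' := by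
  subst ha hb hc hd; rfl

/-- The adjoint action of `[[a, b], [c, d]]` in the coordinates `x, y, z`. -/
noncomputable def adFun (a b c d : ℝ) (v : V) : V :=
  ![(a * d + b * c) * v 0 + (b * d - a * c) * v 1 - (a * c + b * d) * v 2,
    (c * d - a * b) * v 0 + (a ^ 2 - b ^ 2 - c ^ 2 + d ^ 2) / 2 * v 1
      + (a ^ 2 + b ^ 2 - c ^ 2 - d ^ 2) / 2 * v 2,
    -(a * b + c * d) * v 0 + (a ^ 2 - b ^ 2 + c ^ 2 - d ^ 2) / 2 * v 1
      + (a ^ 2 + b ^ 2 + c ^ 2 + d ^ 2) / 2 * v 2]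

theorem adSL_slMk {a b c d : ℝ} (h : a * d - b * c = 1) (v : V) :
    adSL (slMk a b c d h) v = adFun a b c d v := by
  rw [adSL_apply, slMk_inv]
  ext i
  fin_cases i <;> simp [slMk, ofMat, toMat, adFun, Matrix.mul_apply, Fin.sum_univ_two] <;> ring

theorem ad_slMk {a b c d : ℝ} (h : a * d - b * c = 1) (v : V) :
    ad (QuotientGroup.mk (slMk a b c d h)) v = adFun a b c d v := adSL_slMk h v

theorem ad_mul_apply (γ δ : PSL2) (v : V) : ad (γ * δ) v = ad γ (ad δ v) := by
  rw [map_mul]; rfl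

theorem ad_inv_apply_self (γ : PSL2) (v : V) : ad γ⁻¹ (ad γ v) = v := by
  rw [← ad_mul_apply, inv_mul_cancel, map_one]; rfl

theorem ad_apply_inv_self (γ : PSL2) (v : V) : ad γ (ad γ⁻¹ v) = v := by
  rw [← ad_mul_apply, mul_inv_cancel, map_one]; rfl

theorem form_comm (v w : V) : form v w = form w v := by
  rw [form_apply, form_apply]; ring

theorem form_ad_ad (γ : PSL2) (v w : V) : form (ad γ v) (ad γ w) = form v w := by
  have h := form_ad γ (v + w)
  simp only [map_add, LinearMap.add_apply, form_ad] at h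
  rw [form_comm (ad γ w) (ad γ v), form_comm w v] at h
  linarith

theorem form_ad_left (γ : PSL2) (v w : V) : form (ad γ v) w = form v (ad γ⁻¹ w) := by
  rw [← form_ad_ad γ v, ad_apply_inv_self]

/-- Twice the third coordinate of the image is the sum of the values at the two rows of the matrix
of the binary quadratic form `(z + y) p² - 2 x p q + (z - y) q²`. Its determinant is `-form v v`, so
it is positive definite, and the rows are not both zero. -/
theorem ad_two_pos (γ : PSL2) {v : V} (h : form v v < 0) (hv : 0 < v 2) : 0 < ad γ v 2 := by
  induction γ using QuotientGroup.induction_on with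
  | H A =>
    obtain ⟨a, b, c, d, hA, rfl⟩ := exists_slMk A
    rw [ad_slMk]
    rw [form_apply] at h
    have key : ∀ p q : ℝ, 0 ≤ (v 2 + v 1) * p ^ 2 - 2 * v 0 * p * q + (v 2 - v 1) * q ^ 2 ∧
        ((v 2 + v 1) * p ^ 2 - 2 * v 0 * p * q + (v 2 - v 1) * q ^ 2 = 0 → p = 0 ∧ q = 0) := by
      intro p q
      have hs : 0 < v 2 + v 1 := by nlinarith [mul_self_nonneg (v 0)]
      have e : (v 2 + v 1) * ((v 2 + v 1) * p ^ 2 - 2 * v 0 * p * q + (v 2 - v 1) * q ^ 2)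
          = ((v 2 + v 1) * p - v 0 * q) ^ 2
            + (v 2 * v 2 - v 0 * v 0 - v 1 * v 1) * q ^ 2 := by ring
      have hd : 0 < v 2 * v 2 - v 0 * v 0 - v 1 * v 1 := by linarith
      constructor
      · by_contra hn
        push Not at hn
        have := mul_neg_of_pos_of_neg hs hn
        have := mul_nonneg hd.le (sq_nonneg q)
        nlinarith [sq_nonneg ((v 2 + v 1) * p - v 0 * q)]
      · intro h0
        rw [h0, mul_zero] at e
        have h1 := mul_nonneg hd.le (sq_nonneg q)
        have h2 := sq_nonneg ((v 2 + v 1) * p - v 0 * q)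
        have hq : q = 0 := by
          have : (v 2 * v 2 - v 0 * v 0 - v 1 * v 1) * q ^ 2 = 0 := by linarith
          simpa [hd.ne'] using this
        have hp : (v 2 + v 1) * p - v 0 * q = 0 := by
          have : ((v 2 + v 1) * p - v 0 * q) ^ 2 = 0 := by linarith
          simpa using this
        rw [hq, mul_zero, sub_zero] at hp
        exact ⟨by simpa [hs.ne'] using hp, hq⟩
    have e : adFun a b c d v 2 =
        (((v 2 + v 1) * a ^ 2 - 2 * v 0 * a * b + (v 2 - v 1) * b ^ 2) +
        ((v 2 + v 1) * c ^ 2 - 2 * v 0 * c * d + (v 2 - v 1) * d ^ 2)) / 2 := by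
      simp [adFun]; ring
    rw [e]
    by_contra hn
    have h1 := key a b
    have h2 := key c d
    have h0 := h1.2 (by linarith)
    rw [h0.1, h0.2] at hA
    simp at hA

theorem ad_injective : Function.Injective ad := by
  rw [injective_iff_map_eq_one]
  intro γ hγ
  induction γ using QuotientGroup.induction_on with
  | H A =>
    obtain ⟨a, b, c, d, hA, rfl⟩ := exists_slMk A
    have h : ∀ v : V, adFun a b c d v = v := fun v => by
      rw [← ad_slMk hA, hγ]; rfl
    have h1 := congrFun (h ![1, 0, 0]) 0
    have h20 := congrFun (h ![0, 1, 0]) 1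
    have h22 := congrFun (h ![0, 0, 1]) 2
    simp [adFun] at h1 h20 h22
    -- The two diagonal entries `h20` and `h22` differ by `b² + c²`.
    have hb : b = 0 := by nlinarith [sq_nonneg b, sq_nonneg c]
    have hc : c = 0 := by nlinarith [sq_nonneg b, sq_nonneg c]
    subst hb hc
    have had : a = d := by nlinarith [sq_nonneg (a - d)]
    subst had
    rw [QuotientGroup.eq_one_iff]
    refine Matrix.SpecialLinearGroup.mem_center_iff.2 ⟨a, by rw [Fintype.card_fin]; linear_combination hA, ?_⟩
    ext i j
    fin_cases i <;> fin_cases j <;> simp [slMk]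

theorem ad_ext {γ δ : PSL2} (h : ∀ v, ad γ v = ad δ v) : γ = δ :=
  ad_injective (LinearEquiv.ext h)

/-! ### Unit normals of euclidean planes -/

theorem coord_lt_one (X : Psi) : coord X 0 ^ 2 + coord X 1 ^ 2 < 1 := by
  have : coord X ∈ coordDomain := range_coord ▸ Set.mem_range_self X
  exact this

noncomputable def normFactor (X : Psi) : ℝ := (√(1 - coord X 0 ^ 2 - coord X 1 ^ 2))⁻¹

theorem normFactor_pos (X : Psi) : 0 < normFactor X :=
  inv_pos.2 (Real.sqrt_pos.2 (by linarith [coord_lt_one X]))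

theorem normFactor_sq (X : Psi) : normFactor X ^ 2 * (1 - coord X 0 ^ 2 - coord X 1 ^ 2) = 1 := by
  have h : 0 < 1 - coord X 0 ^ 2 - coord X 1 ^ 2 := by linarith [coord_lt_one X]
  rw [normFactor, inv_pow, Real.sq_sqrt h.le, inv_mul_cancel₀ h.ne']

/-- The unit normal vector of a euclidean plane. -/
noncomputable def normal (X : Psi) : V :=
  ![normFactor X * coord X 0, normFactor X * coord X 1, normFactor X]

/-- The height of a euclidean plane: `X` has the equation `form (normal X) p + height X = 0`. -/
noncomputable def height (X : Psi) : ℝ := normFactor X * coord X 2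

theorem mem_iff_normal (X : Psi) (p : V) : p ∈ X.1 ↔ form (normal X) p + height X = 0 := by
  have h : form (normal X) p + height X
      = normFactor X * (coord X 0 * p 0 + coord X 1 * p 1 + coord X 2 - p 2) := by
    simp [form_apply, normal, height]; ring
  rw [mem_iff_coord, h, mul_eq_zero_iff_left (normFactor_pos X).ne']
  constructor <;> intro h <;> linarith

theorem form_normal (X : Psi) : form (normal X) (normal X) = -1 := by
  simp [form_apply, normal]
  linear_combination -normFactor_sq X

theorem normal_two_pos (X : Psi) : 0 < normal X 2 := normFactor_pos X

theorem coord_zero (X : Psi) : coord X 0 = normal X 0 / normal X 2 := by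
  simp [normal, (normFactor_pos X).ne']

theorem coord_one (X : Psi) : coord X 1 = normal X 1 / normal X 2 := by
  simp [normal, (normFactor_pos X).ne']

theorem coord_two (X : Psi) : coord X 2 = height X / normal X 2 := by
  simp [normal, height, (normFactor_pos X).ne']

theorem psi_ext {X Y : Psi} (hn : normal X = normal Y) (hh : height X = height Y) : X = Y := by
  refine Subtype.ext (SetLike.ext fun p => ?_)
  rw [mem_iff_normal, mem_iff_normal, hn, hh]

/-- Together with `psi_ext`: normal and height identify `Ψ` with the product of the upper sheet of
the hyperboloid and `ℝ`. -/
theorem exists_psi {n : V} (hn : form n n = -1) (h2 : 0 < n 2) (k : ℝ) :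
    ∃ X, normal X = n ∧ height X = k := by
  rw [form_apply] at hn
  have hlt : (n 0 / n 2) ^ 2 + (n 1 / n 2) ^ 2 < 1 := by
    rw [div_pow, div_pow, ← add_div, div_lt_one (by positivity)]
    linarith
  let w : coordDomain := ⟨!₂[n 0 / n 2, n 1 / n 2, k / n 2], by simpa [coordDomain] using hlt⟩
  have h0 : coord (ofCoord w) 0 = n 0 / n 2 := by rw [coord_ofCoord]; simp [w]
  have h1 : coord (ofCoord w) 1 = n 1 / n 2 := by rw [coord_ofCoord]; simp [w]
  have hk : coord (ofCoord w) 2 = k / n 2 := by rw [coord_ofCoord]; simp [w]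
  have hf : normFactor (ofCoord w) = n 2 := by
    have := normFactor_sq (ofCoord w)
    rw [h0, h1] at this
    field_simp at this
    have hs : normFactor (ofCoord w) ^ 2 = n 2 ^ 2 := by
      linear_combination this + normFactor (ofCoord w) ^ 2 * hn
    exact (pow_left_inj₀ (normFactor_pos _).le h2.le two_ne_zero).1 hs
  refine ⟨ofCoord w, ?_, ?_⟩
  · ext i
    fin_cases i <;> simp [normal, hf, h0, h1] <;> field_simp
  · rw [height, hf, hk]; field_simp

/-- The reversed Cauchy–Schwarz inequality for timelike vectors in the same half of the cone. -/
theorem form_neg {n w : V} (hn : form n n < 0) (hn2 : 0 < n 2) (hw : form w w < 0)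
    (hw2 : 0 < w 2) : form n w < 0 := by
  rw [form_apply] at *
  have h1 : (n 0 * w 0 + n 1 * w 1) ^ 2 < (n 2 * w 2) ^ 2 := by
    have h2 : (n 0 * w 0 + n 1 * w 1) ^ 2 ≤ (n 0 * n 0 + n 1 * n 1) * (w 0 * w 0 + w 1 * w 1) := by
      nlinarith [sq_nonneg (n 0 * w 1 - n 1 * w 0)]
    have h3 : (n 0 * n 0 + n 1 * n 1) * (w 0 * w 0 + w 1 * w 1) < (n 2 * n 2) * (w 2 * w 2) :=
      mul_lt_mul'' (by linarith) (by linarith)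
        (add_nonneg (mul_self_nonneg _) (mul_self_nonneg _))
        (add_nonneg (mul_self_nonneg _) (mul_self_nonneg _))
    nlinarith
  have := abs_lt_of_sq_lt_sq h1 (by positivity)
  linarith [(abs_lt.1 this).2]

/-- One inclusion between two planes suffices: both are graphs over the `x, y`-plane, so the affine
functions agree everywhere and have equal coefficients. -/
theorem eq_normal {X : Psi} {n : V} {k : ℝ} (hn : form n n = -1) (h2 : 0 < n 2)
    (h : ∀ p, p ∈ X.1 → form n p + k = 0) : normal X = n ∧ height X = k := by
  obtain ⟨Y, rfl, rfl⟩ := exists_psi hn h2 k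
  have hXY : X = Y := by
    have hm : ∀ a b : ℝ, coord X 0 * a + coord X 1 * b + coord X 2
        = coord Y 0 * a + coord Y 1 * b + coord Y 2 := fun a b => by
      have hp : (![a, b, coord X 0 * a + coord X 1 * b + coord X 2] : V) ∈ X.1 := by
        rw [mem_iff_coord]; simp
      have := (mem_iff_normal Y _).2 (h _ hp)
      rw [mem_iff_coord] at this
      simpa using this
    refine coord_injective (PiLp.ext fun i => ?_)
    have h00 := hm 0 0
    have h10 := hm 1 0
    have h01 := hm 0 1
    fin_cases i <;> simp <;> linarith
  rw [hXY]; exact ⟨rfl, rfl⟩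

/-! ### The action of `G` on normals and heights -/

/-- Invariance of the form turns the equation of `X` at `q` into the claimed equation at `γ q + v`;
the translation contributes only to the constant term. -/
theorem normal_height_smul (g : G) (X : Psi) : normal (g • X) = ad g.right (normal X) ∧
    height (g • X) = height X - form (ad g.right (normal X)) (Multiplicative.toAdd g.left) := by
  refine eq_normal (by rw [form_ad, form_normal])
    (ad_two_pos _ (by rw [form_normal]; norm_num) (normal_two_pos X)) fun p hp => ?_
  obtain ⟨q, rfl⟩ := (motion g).surjective p
  rw [mem_smul_iff, mem_iff_normal] at hp
  rw [motion_apply, map_add, form_ad_ad]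
  linarith

theorem normal_smul (g : G) (X : Psi) : normal (g • X) = ad g.right (normal X) :=
  (normal_height_smul g X).1

theorem height_smul (g : G) (X : Psi) : height (g • X) =
    height X - form (normal (g • X)) (Multiplicative.toAdd g.left) := by
  rw [(normal_height_smul g X).2, normal_smul]

/-- The motion `p ↦ γ p + v`. -/
noncomputable def mot (v : V) (γ : PSL2) : G := transl v * rot γ

theorem mot_left (v : V) (γ : PSL2) : Multiplicative.toAdd (mot v γ).left = v := by
  simp [mot, transl, rot]

theorem mot_right (v : V) (γ : PSL2) : (mot v γ).right = γ := by
  simp [mot, transl, rot]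

theorem g_ext {g h : G} (hl : Multiplicative.toAdd g.left = Multiplicative.toAdd h.left)
    (hr : g.right = h.right) : g = h := SemidirectProduct.ext hl hr

theorem mot_eta (g : G) : mot (Multiplicative.toAdd g.left) g.right = g :=
  g_ext (mot_left _ _) (mot_right _ _)

theorem mot_inj {v w : V} {γ δ : PSL2} : mot v γ = mot w δ ↔ v = w ∧ γ = δ := by
  constructor
  · intro h
    refine ⟨?_, ?_⟩
    · rw [← mot_left v γ, h, mot_left]
    · rw [← mot_right v γ, h, mot_right]
  · rintro ⟨rfl, rfl⟩; rfl

theorem mot_mul (v w : V) (γ δ : PSL2) : mot v γ * mot w δ = mot (v + ad γ w) (γ * δ) := by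
  refine g_ext ?_ ?_
  · rw [SemidirectProduct.mul_left, mot_left, toAdd_mul, mot_left]
    congr 1
    rw [mot_right]
    change ad γ (Multiplicative.toAdd (mot w δ).left) = _
    rw [mot_left]
  · rw [SemidirectProduct.mul_right, mot_right, mot_right, mot_right]

theorem rot_eq (γ : PSL2) : rot γ = mot 0 γ := by
  simp [mot, transl]

theorem transl_eq (v : V) : transl v = mot v 1 := by
  simp [mot, rot]

theorem mot_one : mot 0 1 = 1 := by simp [mot, rot, transl]

theorem mot_inv (v : V) (γ : PSL2) : (mot v γ)⁻¹ = mot (-ad γ⁻¹ v) γ⁻¹ := by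
  rw [inv_eq_iff_mul_eq_one, mot_mul, map_neg, ad_apply_inv_self, add_neg_cancel, mul_inv_cancel,
    mot_one]

theorem normal_mot_smul (v : V) (γ : PSL2) (X : Psi) : normal (mot v γ • X) = ad γ (normal X) := by
  rw [normal_smul, mot_right]

theorem height_mot_smul (v : V) (γ : PSL2) (X : Psi) :
    height (mot v γ • X) = height X - form (ad γ (normal X)) v := by
  rw [height_smul, normal_mot_smul, mot_left]

theorem normal_rot_smul (γ : PSL2) (X : Psi) : normal (rot γ • X) = ad γ (normal X) := by
  rw [rot_eq, normal_mot_smul]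

theorem height_rot_smul (γ : PSL2) (X : Psi) : height (rot γ • X) = height X := by
  rw [rot_eq, height_mot_smul, map_zero, sub_zero]

theorem basePlane_normal : normal basePlane = ![0, 0, 1] ∧ height basePlane = 0 := by
  refine eq_normal (by simp [form_apply]) (by simp) fun p hp => ?_
  have : p 2 = 0 * p 0 + 0 * p 1 + 0 := hp
  simp [form_apply]; linarith

theorem zero_mem_iff (X : Psi) : (0 : V) ∈ X.1 ↔ height X = 0 := by
  rw [mem_iff_normal, map_zero, zero_add]

theorem rot_smul_basePlane {γ : PSL2} :
    rot γ • basePlane = basePlane ↔ ad γ ![0, 0, 1] = ![0, 0, 1] := by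
  constructor
  · intro h
    rw [← basePlane_normal.1, ← normal_rot_smul, h]
  · intro h
    refine psi_ext ?_ (height_rot_smul _ _)
    rw [normal_rot_smul, basePlane_normal.1, h]

/-- The values of the form on three particular unit vectors determine a vector. -/
theorem eq_zero_of_form_eq_zero {v : V} (h1 : form ![0, 0, 1] v = 0)
    (h2 : form ![3 / 4, 0, 5 / 4] v = 0) (h3 : form ![0, 3 / 4, 5 / 4] v = 0) : v = 0 := by
  simp [form_apply] at h1 h2 h3
  ext i
  fin_cases i <;> simp <;> linarith

/-- Three unit normals that form a basis of `ℝ³`; the triple 3, 4, 5 keeps them rational. -/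
theorem exists_normal_base : ∃ X₁ X₂ X₃ : Psi, normal X₁ = ![0, 0, 1] ∧
    normal X₂ = ![3 / 4, 0, 5 / 4] ∧ normal X₃ = ![0, 3 / 4, 5 / 4] := by
  obtain ⟨X₁, h₁, -⟩ := exists_psi (n := ![0, 0, 1]) (by simp [form_apply]) (by simp) 0
  obtain ⟨X₂, h₂, -⟩ := exists_psi (n := ![3 / 4, 0, 5 / 4]) (by simp [form_apply]; norm_num) (by simp) 0
  obtain ⟨X₃, h₃, -⟩ := exists_psi (n := ![0, 3 / 4, 5 / 4]) (by simp [form_apply]; norm_num) (by simp) 0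
  exact ⟨X₁, X₂, X₃, h₁, h₂, h₃⟩

theorem eq_of_normal_forms {v w : V} (h : ∀ X, form (normal X) v = form (normal X) w) : v = w := by
  obtain ⟨X₁, X₂, X₃, h₁, h₂, h₃⟩ := exists_normal_base
  have h' : ∀ X, form (normal X) (v - w) = 0 := fun X => by rw [map_sub, h, sub_self]
  exact sub_eq_zero.1 (eq_zero_of_form_eq_zero (h₁ ▸ h' X₁) (h₂ ▸ h' X₂) (h₃ ▸ h' X₃))

/-- The unit normals span `ℝ³`. Their images determine the linear part, and then the changes of
height determine the translation part. -/
theorem smul_faithful {g h : G} (H : ∀ X : Psi, g • X = h • X) : g = h := by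
  have hr : g.right = h.right := by
    refine ad_ext fun v => ?_
    rw [← ad_inv_apply_self g.right⁻¹ (ad h.right v), inv_inv]
    congr 1
    refine eq_of_normal_forms fun X => ?_
    rw [← form_ad_left, ← normal_smul, H, normal_smul, form_ad_ad]
  refine g_ext (eq_of_normal_forms fun X => ?_) hr
  obtain ⟨Y, rfl⟩ : ∃ Y, g • Y = X := ⟨g⁻¹ • X, smul_inv_smul g X⟩
  have h1 := height_smul g Y
  have h2 := height_smul h Y
  rw [← H] at h2
  linarith

/-! ### The section of the hyperbolic plane loop -/

theorem posDef_slMk {p q r : ℝ} (h : p * r - q * q = 1) (hp : 0 < p) :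
    (slMk p q q r h : Matrix (Fin 2) (Fin 2) ℝ).PosDef := by
  refine Matrix.PosDef.of_dotProduct_mulVec_pos ?_ fun x hx => ?_
  · ext i j
    fin_cases i <;> fin_cases j <;> simp [slMk]
  · have e : star x ⬝ᵥ ((slMk p q q r h : Matrix (Fin 2) (Fin 2) ℝ).mulVec x)
        = p * x 0 ^ 2 + 2 * q * x 0 * x 1 + r * x 1 ^ 2 := by
      simp [slMk, Matrix.mulVec, dotProduct, Fin.sum_univ_two]; ring
    rw [e]
    have e' : p * (p * x 0 ^ 2 + 2 * q * x 0 * x 1 + r * x 1 ^ 2)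
        = (p * x 0 + q * x 1) ^ 2 + x 1 ^ 2 := by linear_combination x 1 ^ 2 * h
    refine pos_of_mul_pos_right (a := p) ?_ hp.le
    rw [e']
    by_contra hn
    have h1 : x 1 = 0 := by nlinarith [sq_nonneg (p * x 0 + q * x 1), sq_nonneg (x 1)]
    have h0 : p * x 0 = 0 := by
      rw [h1] at hn
      nlinarith [sq_nonneg (p * x 0)]
    refine hx (funext fun i => ?_)
    fin_cases i
    · simpa [hp.ne'] using h0
    · exact h1

theorem exists_slMk_of_posDef {A : SL(2, ℝ)} (hA : (A : Matrix (Fin 2) (Fin 2) ℝ).PosDef) :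
    ∃ p q r h, 0 < p ∧ A = slMk p q q r h := by
  obtain ⟨a, b, c, d, h, rfl⟩ := exists_slMk A
  have h1 : b = c := by simpa [slMk] using hA.isHermitian.apply 1 0
  have h2 : 0 < a := by simpa [slMk] using hA.diag_pos (i := 0)
  subst h1
  exact ⟨a, b, d, h, h2, rfl⟩

theorem mem_hypSectionStd {γ : PSL2} :
    γ ∈ hypSectionStd ↔ ∃ p q r h, 0 < p ∧ QuotientGroup.mk (slMk p q q r h) = γ := by
  constructor
  · rintro ⟨A, hA, rfl⟩
    obtain ⟨p, q, r, h, hp, rfl⟩ := exists_slMk_of_posDef hA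
    exact ⟨p, q, r, h, hp, rfl⟩
  · rintro ⟨p, q, r, h, hp, rfl⟩
    exact ⟨_, posDef_slMk h hp, rfl⟩

theorem exists_slMk_of_stabilizer {γ : PSL2} (hγ : rot γ • basePlane = basePlane) :
    ∃ a b h, γ = QuotientGroup.mk (slMk a (-b) b a h) := by
  rw [rot_smul_basePlane] at hγ
  induction γ using QuotientGroup.induction_on with
  | H A =>
    obtain ⟨a, b, c, d, h, rfl⟩ := exists_slMk A
    rw [ad_slMk] at hγ
    have h0 := congrFun hγ 0
    have h1 := congrFun hγ 1
    have h2 := congrFun hγ 2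
    simp [adFun] at h0 h1 h2
    -- With determinant 1, the third coordinate `a² + b² + c² + d² = 2` says that `(a - d)² + (b +
    -- c)² = 0`.
    have had : d = a := by nlinarith [sq_nonneg (a - d), sq_nonneg (b + c)]
    have hbc : b = -c := by nlinarith [sq_nonneg (a - d), sq_nonneg (b + c)]
    subst had hbc
    exact ⟨d, c, h, rfl⟩

/-- The stabilizer consists of rotation matrices, whose inverse is the transpose, so conjugation is
a congruence and preserves positive definite symmetric matrices. This is why `hypSection` does not
depend on the choice of `γ`. -/
theorem conj_mem_hypSectionStd {γ δ : PSL2} (hγ : rot γ • basePlane = basePlane)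
    (hδ : δ ∈ hypSectionStd) : γ * δ * γ⁻¹ ∈ hypSectionStd := by
  obtain ⟨a, b, h, rfl⟩ := exists_slMk_of_stabilizer hγ
  obtain ⟨p, q, r, h', hp, rfl⟩ := mem_hypSectionStd.1 hδ
  have e : p * (a ^ 2 * p - 2 * a * b * q + b ^ 2 * r) = (a * p - b * q) ^ 2 + b ^ 2 := by
    linear_combination b ^ 2 * h'
  have hpos : 0 < a ^ 2 * p - 2 * a * b * q + b ^ 2 * r := by
    refine pos_of_mul_pos_right (a := p) ?_ hp.le
    rw [e]
    by_contra hn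
    have hb : b = 0 := by nlinarith [sq_nonneg (a * p - b * q), sq_nonneg b]
    have ha : a * p = 0 := by
      rw [hb] at hn
      nlinarith [sq_nonneg (a * p)]
    have ha : a = 0 := by simpa [hp.ne'] using ha
    rw [ha, hb] at h
    norm_num at h
  refine mem_hypSectionStd.2 ⟨a ^ 2 * p - 2 * a * b * q + b ^ 2 * r,
    a * b * p + (a ^ 2 - b ^ 2) * q - a * b * r, b ^ 2 * p + 2 * a * b * q + a ^ 2 * r, ?_, hpos, ?_⟩
  · linear_combination (a * a + b * b) ^ 2 * h' + (a * a + b * b + 1) * h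
  · rw [← QuotientGroup.mk_mul, ← QuotientGroup.mk_inv, ← QuotientGroup.mk_mul, slMk_inv, slMk_mul,
      slMk_mul]
    congr 1
    apply slMk_congr <;> ring

theorem mem_hypSection_basePlane {σ : G} :
    σ ∈ hypSection basePlane ↔ ∃ δ ∈ hypSectionStd, σ = rot δ := by
  constructor
  · rintro ⟨γ, hγ, δ, hδ, rfl⟩
    exact ⟨_, conj_mem_hypSectionStd hγ hδ, rfl⟩
  · rintro ⟨δ, hδ, rfl⟩
    refine ⟨1, ?_, δ, hδ, by simp⟩
    rw [rot_eq, mot_one, one_smul]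

theorem mem_theta_basePlane {W : Submodule ℝ V} {ρ : G} :
    ρ ∈ theta basePlane W ↔ ∃ w ∈ W, ∃ δ ∈ hypSectionStd, ρ = mot w δ := by
  constructor
  · rintro ⟨_, ⟨w, hw, rfl⟩, σ, hσ, rfl⟩
    obtain ⟨δ, hδ, rfl⟩ := mem_hypSection_basePlane.1 hσ
    exact ⟨w, hw, δ, hδ, rfl⟩
  · rintro ⟨w, hw, δ, hδ, rfl⟩
    exact ⟨_, ⟨w, hw, rfl⟩, _, mem_hypSection_basePlane.2 ⟨δ, hδ, rfl⟩, rfl⟩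

theorem one_mem_hypSectionStd : (1 : PSL2) ∈ hypSectionStd :=
  ⟨1, Matrix.PosDef.one, rfl⟩

theorem transl_mem_theta {W : Submodule ℝ V} {w : V} (hw : w ∈ W) :
    transl w ∈ theta basePlane W :=
  mem_theta_basePlane.2 ⟨w, hw, 1, one_mem_hypSectionStd, transl_eq w⟩

theorem rot_mem_theta (W : Submodule ℝ V) {δ : PSL2} (hδ : δ ∈ hypSectionStd) :
    rot δ ∈ theta basePlane W :=
  mem_theta_basePlane.2 ⟨0, W.zero_mem, δ, hδ, rot_eq δ⟩

/-! ### Sharp transitivity on the hyperbolic plane -/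

theorem form_normal_neg (X Y : Psi) : form (normal X) (normal Y) < 0 :=
  form_neg (by rw [form_normal]; norm_num) (normal_two_pos X) (by rw [form_normal]; norm_num)
    (normal_two_pos Y)

theorem abs_normal_one_lt (X : Psi) : |normal X 1| < normal X 2 := by
  refine abs_lt_of_sq_lt_sq ?_ (normal_two_pos X).le
  have := form_normal X
  rw [form_apply] at this
  nlinarith [mul_self_nonneg (normal X 0)]

/-- The square of the denominator of the entries of `hypMove`. -/
noncomputable def hypDenSq (X Y : Psi) : ℝ :=
  2 + 2 * (normal X 0 * normal Y 0 + normal X 1 * normal Y 1 + normal X 2 * normal Y 2)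

theorem hypDenSq_pos (X Y : Psi) : 0 < hypDenSq X Y := by
  -- Reversing the first two coordinates of one normal turns the euclidean inner product into minus
  -- the form.
  have h := form_neg (n := ![-normal X 0, -normal X 1, normal X 2]) (w := normal Y)
    (by
      have := form_normal X
      rw [form_apply] at this
      simp [form_apply]
      linarith) (normal_two_pos X) (by rw [form_normal]; norm_num) (normal_two_pos Y)
  simp [form_apply] at h
  rw [hypDenSq]
  linarith

noncomputable def hypDen (X Y : Psi) : ℝ := √(hypDenSq X Y)

theorem hypDen_pos (X Y : Psi) : 0 < hypDen X Y := Real.sqrt_pos.2 (hypDenSq_pos X Y)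

theorem hypDen_sq (X Y : Psi) : hypDen X Y ^ 2 =
    2 + 2 * (normal X 0 * normal Y 0 + normal X 1 * normal Y 1 + normal X 2 * normal Y 2) :=
  Real.sq_sqrt (hypDenSq_pos X Y).le

/-- Encode a normal `(x, y, z)` as the positive definite symmetric matrix `N = [[z + y, -x], [-x, z
- y]]` of determinant 1; then `A` acts by `N ↦ A N Aᵀ`. For symmetric `A` with `A N A = N'`,
Cayley–Hamilton for `A N` gives `t A = N' + N⁻¹` with `t = tr (A N)`. The numerators here are the
entries of `N' + N⁻¹`, and taking determinants yields `t² = hypDenSq`. -/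
noncomputable def hypP (X Y : Psi) : ℝ :=
  (normal X 2 + normal Y 2 + normal Y 1 - normal X 1) / hypDen X Y

noncomputable def hypQ (X Y : Psi) : ℝ := (normal X 0 - normal Y 0) / hypDen X Y

noncomputable def hypR (X Y : Psi) : ℝ :=
  (normal X 2 + normal Y 2 - normal Y 1 + normal X 1) / hypDen X Y

theorem hyp_det (X Y : Psi) : hypP X Y * hypR X Y - hypQ X Y * hypQ X Y = 1 := by
  have h := hypDen_sq X Y
  have hX := form_normal X
  have hY := form_normal Y
  have h0 := (hypDen_pos X Y).ne'
  rw [form_apply] at hX hY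
  rw [hypP, hypQ, hypR]
  field_simp
  linear_combination -h - hX - hY

theorem hypP_pos (X Y : Psi) : 0 < hypP X Y := by
  have h1 := abs_lt.1 (abs_normal_one_lt X)
  have h2 := abs_lt.1 (abs_normal_one_lt Y)
  exact div_pos (by linarith) (hypDen_pos X Y)

/-- The hyperbolic translation in `hypSectionStd` moving the unit normal of `X` to that of `Y`. -/
noncomputable def hypMove (X Y : Psi) : SL(2, ℝ) :=
  slMk (hypP X Y) (hypQ X Y) (hypQ X Y) (hypR X Y) (hyp_det X Y)

theorem hypMove_mem (X Y : Psi) : (QuotientGroup.mk (hypMove X Y) : PSL2) ∈ hypSectionStd :=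
  ⟨_, posDef_slMk _ (hypP_pos X Y), rfl⟩

theorem ad_hypMove (X Y : Psi) : ad (QuotientGroup.mk (hypMove X Y)) (normal X) = normal Y := by
  have h := hypDen_sq X Y
  have hX := form_normal X
  have hY := form_normal Y
  have h0 := (hypDen_pos X Y).ne'
  rw [form_apply] at hX hY
  rw [hypMove, ad_slMk]
  ext i
  fin_cases i <;> simp only [adFun, hypP, hypQ, hypR, Fin.zero_eta, Fin.isValue, Fin.mk_one,
    Fin.reduceFinMk, Matrix.cons_val_zero, Matrix.cons_val_one, Matrix.cons_val] <;> field_simp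
  · linear_combination (-2 * normal Y 0 + normal X 0) * hX - normal X 0 * hY - normal Y 0 * h
  · linear_combination 2 * (-2 * normal Y 1 + normal X 1) * hX - 2 * normal X 1 * hY
      - 2 * normal Y 1 * h
  · linear_combination 2 * (-2 * normal Y 2 - normal X 2) * hX + 2 * normal X 2 * hY
      - 2 * normal Y 2 * h

theorem eq_hypMove {X Y : Psi} {δ : PSL2} (hδ : δ ∈ hypSectionStd)
    (h : ad δ (normal X) = normal Y) : δ = QuotientGroup.mk (hypMove X Y) := by
  obtain ⟨p, q, r, hd, hp, rfl⟩ := mem_hypSectionStd.1 hδ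
  rw [ad_slMk] at h
  have e0 : _ = normal Y 0 := congrFun h 0
  have e1 : _ = normal Y 1 := congrFun h 1
  have e2 : _ = normal Y 2 := congrFun h 2
  simp only [adFun, Matrix.cons_val_zero, Matrix.cons_val_one, Matrix.cons_val] at e0 e1 e2
  have hX := form_normal X
  have hD := hypDen_sq X Y
  have hY := form_normal Y
  rw [form_apply] at hX hY
  -- `t` is the trace of `A N`; the next three identities are the entries of `t A = N' + N⁻¹`.
  obtain ⟨t, ht⟩ : ∃ t, t = p * (normal X 2 + normal X 1) - 2 * q * normal X 0
      + r * (normal X 2 - normal X 1) := ⟨_, rfl⟩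
  have tp : t * p = normal X 2 + normal Y 2 + normal Y 1 - normal X 1 := by
    rw [← e1, ← e2, ht]; linear_combination (normal X 2 - normal X 1) * hd
  have tq : t * q = normal X 0 - normal Y 0 := by
    rw [← e0, ht]; linear_combination normal X 0 * hd
  have tr : t * r = normal X 2 + normal Y 2 - normal Y 1 + normal X 1 := by
    rw [← e1, ← e2, ht]; linear_combination (normal X 2 + normal X 1) * hd
  have tpos : 0 < t := by
    have h1 := abs_lt.1 (abs_normal_one_lt X)
    have h2 := abs_lt.1 (abs_normal_one_lt Y)
    exact pos_of_mul_pos_left (b := p) (by linarith) hp.le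
  -- The determinant of `t A` is `t²`; positivity of `t` then selects the root `hypDen`.
  have tsq : t ^ 2 = hypDen X Y ^ 2 := by
    have : t ^ 2 = (t * p) * (t * r) - (t * q) * (t * q) := by linear_combination -t ^ 2 * hd
    rw [this, tp, tq, tr]
    linear_combination -hD - hX - hY
  have tD : t = hypDen X Y := (pow_left_inj₀ tpos.le (hypDen_pos X Y).le two_ne_zero).1 tsq
  congr 1
  refine slMk_congr _ _ ?_ ?_ ?_ ?_
  · rw [hypP, ← tD, eq_div_iff tpos.ne', ← tp, mul_comm]
  · rw [hypQ, ← tD, eq_div_iff tpos.ne', ← tq, mul_comm]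
  · rw [hypQ, ← tD, eq_div_iff tpos.ne', ← tq, mul_comm]
  · rw [hypR, ← tD, eq_div_iff tpos.ne', ← tr, mul_comm]

/-! ### Admissible lines -/

/-- On the line spanned by `w` the equation of a plane becomes linear in the coefficient of `w`,
with leading coefficient `form (normal X) w`. -/
theorem isTransversal_iff {W : Submodule ℝ V} : IsTransversal W ↔
    ∃ w, W = Submodule.span ℝ {w} ∧ ∀ X, form (normal X) w ≠ 0 := by
  constructor
  · rintro ⟨h1, h⟩
    obtain ⟨⟨w, hw⟩, hw0, hspan⟩ := finrank_eq_one_iff'.1 h1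
    refine ⟨w, le_antisymm ?_ ((Submodule.span_singleton_le_iff_mem _ _).2 hw), fun X h0 => ?_⟩
    · intro v hv
      obtain ⟨c, hc⟩ := hspan ⟨v, hv⟩
      exact Submodule.mem_span_singleton.2 ⟨c, congrArg Subtype.val hc⟩
    -- If the coefficient vanished, the parallel plane through the origin would meet the line in
    -- both `0` and `w`.
    · obtain ⟨Y, hY, hY0⟩ := exists_psi (form_normal X) (normal_two_pos X) 0
      refine hw0 (Subtype.ext ((h Y).unique ⟨hw, ?_⟩ ⟨W.zero_mem, ?_⟩))
      · rw [mem_iff_normal, hY, hY0, h0, add_zero]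
      · exact (zero_mem_iff Y).2 hY0
  · rintro ⟨w, rfl, h⟩
    have hw : w ≠ 0 := by
      rintro rfl
      exact h basePlane (map_zero _)
    refine ⟨finrank_span_singleton hw, fun X => ?_⟩
    refine ⟨(-height X / form (normal X) w) • w, ⟨Submodule.smul_mem _ _
      (Submodule.mem_span_singleton_self w), ?_⟩, ?_⟩
    · rw [mem_iff_normal, map_smul, smul_eq_mul, div_mul_cancel₀ _ (h X), neg_add_cancel]
    · rintro p ⟨hp, hpX⟩
      obtain ⟨c, rfl⟩ := Submodule.mem_span_singleton.1 hp
      rw [mem_iff_normal, map_smul, smul_eq_mul] at hpX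
      congr 1
      rw [eq_div_iff (h X)]
      linarith

theorem isTransversal_map {W : Submodule ℝ V} (h : IsTransversal W) (γ : PSL2) :
    IsTransversal (W.map (ad γ).toLinearMap) := by
  obtain ⟨w, rfl, hw⟩ := isTransversal_iff.1 h
  refine isTransversal_iff.2 ⟨ad γ w, ?_, fun X => ?_⟩
  · rw [Submodule.map_span, Set.image_singleton]; rfl
  · have := hw (rot γ⁻¹ • X)
    rwa [normal_rot_smul, form_ad_left, inv_inv] at this

theorem map_map_ad (W : Submodule ℝ V) (γ δ : PSL2) :
    (W.map (ad δ).toLinearMap).map (ad γ).toLinearMap = W.map (ad (γ * δ)).toLinearMap := by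
  rw [← Submodule.map_comp, map_mul]; rfl

theorem map_ad_one (W : Submodule ℝ V) : W.map (ad 1).toLinearMap = W := by
  rw [map_one]; exact Submodule.map_id W

/-! ### Conjugation of the sections -/

theorem rot_mul (γ δ : PSL2) : rot (γ * δ) = rot γ * rot δ := map_mul SemidirectProduct.inr γ δ

theorem rot_inv (γ : PSL2) : rot γ⁻¹ = (rot γ)⁻¹ := map_inv SemidirectProduct.inr γ

theorem rot_conj_transl (γ : PSL2) (v : V) : rot γ * transl v * (rot γ)⁻¹ = transl (ad γ v) := by
  rw [← rot_inv, rot_eq, rot_eq, transl_eq, transl_eq, mot_mul, mot_mul]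
  simp

theorem conj_mem_theta {P : Psi} {W : Submodule ℝ V} {ρ : G} (γ : PSL2) (h : ρ ∈ theta P W) :
    rot γ * ρ * (rot γ)⁻¹ ∈ theta (rot γ • P) (W.map (ad γ).toLinearMap) := by
  obtain ⟨_, ⟨w, hw, rfl⟩, _, ⟨β, hβ, δ, hδ, rfl⟩, rfl⟩ := h
  refine ⟨_, ⟨_, Submodule.mem_map_of_mem hw, rfl⟩, _, ⟨γ * β, ?_, δ, hδ, rfl⟩, ?_⟩
  · rw [rot_mul, mul_smul, hβ]
  · change _ = transl (ad γ w) * _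
    rw [← rot_conj_transl]
    simp only [rot_mul, rot_inv, mul_inv_rev]
    group

theorem mem_theta_conj {P : Psi} {W : Submodule ℝ V} {ρ : G} (γ : PSL2) :
    ρ ∈ theta (rot γ • P) (W.map (ad γ).toLinearMap) ↔ (rot γ)⁻¹ * ρ * rot γ ∈ theta P W := by
  constructor
  · intro h
    have := conj_mem_theta γ⁻¹ h
    rwa [map_map_ad, ← mul_smul, ← rot_mul, inv_mul_cancel, map_ad_one, rot_eq 1, mot_one,
      one_smul, rot_inv, inv_inv] at this
  · intro h
    have := conj_mem_theta γ h
    rwa [show rot γ * ((rot γ)⁻¹ * ρ * rot γ) * (rot γ)⁻¹ = ρ by group] at this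

theorem exists_rot_basePlane {P : Psi} (hP : (0 : V) ∈ P.1) : ∃ γ, rot γ • basePlane = P := by
  refine ⟨QuotientGroup.mk (hypMove basePlane P), psi_ext ?_ ?_⟩
  · rw [normal_rot_smul, ad_hypMove]
  · rw [height_rot_smul, basePlane_normal.2, (zero_mem_iff P).1 hP]

theorem mem_polarLine {P : Psi} {v : V} : v ∈ polarLine P ↔ ∃ c : ℝ, c • normal P = v := by
  have hdir : ∀ u, u ∈ P.1.direction ↔ form (normal P) u = 0 := fun u => by
    obtain ⟨p, hp⟩ := P.2.1
    rw [← AffineSubspace.vadd_mem_iff_mem_direction u hp, mem_iff_normal, vadd_eq_add, map_add]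
    have := (mem_iff_normal P p).1 hp
    constructor <;> intro h <;> linarith
  rw [polarLine, LinearMap.BilinForm.mem_orthogonal_iff]
  constructor
  · intro h
    refine ⟨-form (normal P) v, ?_⟩
    -- `u` is the component of `v` along the plane. It is orthogonal to both `v` and the normal,
    -- hence to itself, and definiteness on the plane makes it zero.
    obtain ⟨u, hu⟩ : ∃ u, u = v + form (normal P) v • normal P := ⟨_, rfl⟩
    have hnu : form (normal P) u = 0 := by
      rw [hu, map_add, map_smul, form_normal, smul_eq_mul]; ring
    have huu : form u u = 0 := by
      have h1 : form u v = 0 := h u ((hdir u).2 hnu)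
      nth_rw 2 [hu]
      rw [map_add, map_smul, h1, form_comm u, hnu, smul_zero, add_zero]
    by_contra hne
    have := P.2.2.2 u ((hdir u).2 hnu) (by
      rintro rfl
      apply hne
      rw [neg_smul]
      exact (eq_neg_of_add_eq_zero_left hu.symm).symm)
    linarith
  · rintro ⟨c, rfl⟩ u hu
    change form u _ = 0
    rw [map_smul, form_comm, (hdir u).1 hu, smul_zero]

theorem polarLine_eq_span (P : Psi) : polarLine P = Submodule.span ℝ {normal P} := by
  ext v
  rw [mem_polarLine, Submodule.mem_span_singleton]

theorem isTransversal_polarLine (P : Psi) : IsTransversal (polarLine P) :=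
  isTransversal_iff.2 ⟨_, polarLine_eq_span P, fun X => (form_normal_neg X P).ne⟩

theorem polarLine_rot_smul (γ : PSL2) (P : Psi) :
    polarLine (rot γ • P) = (polarLine P).map (ad γ).toLinearMap := by
  rw [polarLine_eq_span, polarLine_eq_span, Submodule.map_span, Set.image_singleton,
    normal_rot_smul]
  rfl

/-! ### Smooth maps into `Ψ` -/

section Smooth

variable {E H M : Type*} [NormedAddCommGroup E] [NormedSpace ℝ E] [TopologicalSpace H]
  {I : ModelWithCorners ℝ E H} [TopologicalSpace M] [ChartedSpace H M]

theorem contMDiff_sqrt {f : M → ℝ} (hf : ContMDiff I 𝓘(ℝ, ℝ) ∞ f) (h : ∀ m, 0 < f m) :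
    ContMDiff I 𝓘(ℝ, ℝ) ∞ (fun m => √(f m)) := fun m =>
  (Real.contDiffAt_sqrt (h m).ne').contMDiffAt.comp m (hf m)

theorem contMDiff_coord_iff {f : M → Psi} : ContMDiff I (𝓡 3) ∞ f ↔
    ∀ i, ContMDiff I 𝓘(ℝ, ℝ) ∞ (fun m => coord (f m) i) := by
  constructor
  · intro hf i
    have h1 : ContMDiff (𝓡 3) (𝓡 3) ∞ coord := contMDiff_isOpenEmbedding isOpenEmbedding_coord
    exact (EuclideanSpace.proj (𝕜 := ℝ) i).contDiff.contMDiff.comp (h1.comp hf)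
  · intro h
    refine ContMDiff.of_comp_isOpenEmbedding isOpenEmbedding_coord ?_
    have h1 : ContMDiff I 𝓘(ℝ, Fin 3 → ℝ) ∞ (fun m i => coord (f m) i) :=
      contMDiff_pi_space.2 h
    exact (EuclideanSpace.equiv (Fin 3) ℝ).symm.contDiff.contMDiff.comp h1

/-- Smoothness may be tested on normals and heights, where the action of `G` is polynomial; the
square root in `normFactor` is harmless because its argument is positive. -/
theorem contMDiff_psi_iff {f : M → Psi} : ContMDiff I (𝓡 3) ∞ f ↔
    (∀ i, ContMDiff I 𝓘(ℝ, ℝ) ∞ (fun m => normal (f m) i)) ∧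
      ContMDiff I 𝓘(ℝ, ℝ) ∞ (fun m => height (f m)) := by
  rw [contMDiff_coord_iff]
  constructor
  · intro h
    have hpos : ∀ m, 0 < 1 - coord (f m) 0 ^ 2 - coord (f m) 1 ^ 2 := fun m => by
      linarith [coord_lt_one (f m)]
    have hn : ContMDiff I 𝓘(ℝ, ℝ) ∞ (fun m => normFactor (f m)) :=
      (contMDiff_sqrt ((contMDiff_const.sub ((h 0).pow 2)).sub ((h 1).pow 2)) hpos).inv₀
        (fun m => (Real.sqrt_pos.2 (hpos m)).ne')
    refine ⟨fun i => ?_, hn.mul (h 2)⟩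
    fin_cases i
    exacts [hn.mul (h 0), hn.mul (h 1), hn]
  · rintro ⟨h, hk⟩ i
    have h0 : ∀ m, normal (f m) 2 ≠ 0 := fun m => (normal_two_pos _).ne'
    fin_cases i
    · exact ((h 0).div₀ (h 2) h0).congr fun m => coord_zero _
    · exact ((h 1).div₀ (h 2) h0).congr fun m => coord_one _
    · exact (hk.div₀ (h 2) h0).congr fun m => coord_two _

theorem contMDiff_form {v w : M → V} (hv : ∀ i, ContMDiff I 𝓘(ℝ, ℝ) ∞ (fun m => v m i))
    (hw : ∀ i, ContMDiff I 𝓘(ℝ, ℝ) ∞ (fun m => w m i)) :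
    ContMDiff I 𝓘(ℝ, ℝ) ∞ (fun m => form (v m) (w m)) :=
  (((hv 0).mul (hw 0)).add ((hv 1).mul (hw 1))).sub ((hv 2).mul (hw 2))

theorem contMDiff_adFun {a b c d : M → ℝ} {v : M → V} (ha : ContMDiff I 𝓘(ℝ, ℝ) ∞ a)
    (hb : ContMDiff I 𝓘(ℝ, ℝ) ∞ b) (hc : ContMDiff I 𝓘(ℝ, ℝ) ∞ c) (hd : ContMDiff I 𝓘(ℝ, ℝ) ∞ d)
    (hv : ∀ i, ContMDiff I 𝓘(ℝ, ℝ) ∞ (fun m => v m i)) (i : Fin 3) :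
    ContMDiff I 𝓘(ℝ, ℝ) ∞ (fun m => adFun (a m) (b m) (c m) (d m) (v m) i) := by
  fin_cases i
  · exact ((((ha.mul hd).add (hb.mul hc)).mul (hv 0)).add
      (((hb.mul hd).sub (ha.mul hc)).mul (hv 1))).sub (((ha.mul hc).add (hb.mul hd)).mul (hv 2))
  · exact ((((hc.mul hd).sub (ha.mul hb)).mul (hv 0)).add
      ((((((ha.pow 2).sub (hb.pow 2)).sub (hc.pow 2)).add (hd.pow 2)).div_const 2).mul (hv 1))).add
      ((((((ha.pow 2).add (hb.pow 2)).sub (hc.pow 2)).sub (hd.pow 2)).div_const 2).mul (hv 2))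
  · exact ((((ha.mul hb).add (hc.mul hd)).neg.mul (hv 0)).add
      ((((((ha.pow 2).sub (hb.pow 2)).add (hc.pow 2)).sub (hd.pow 2)).div_const 2).mul (hv 1))).add
      ((((((ha.pow 2).add (hb.pow 2)).add (hc.pow 2)).add (hd.pow 2)).div_const 2).mul (hv 2))

theorem contMDiff_mot_smul {a b c d : M → ℝ} {h : ∀ m, a m * d m - b m * c m = 1} {v : M → V}
    {X : M → Psi} (ha : ContMDiff I 𝓘(ℝ, ℝ) ∞ a) (hb : ContMDiff I 𝓘(ℝ, ℝ) ∞ b)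
    (hc : ContMDiff I 𝓘(ℝ, ℝ) ∞ c) (hd : ContMDiff I 𝓘(ℝ, ℝ) ∞ d)
    (hv : ∀ i, ContMDiff I 𝓘(ℝ, ℝ) ∞ (fun m => v m i)) (hX : ContMDiff I (𝓡 3) ∞ X) :
    ContMDiff I (𝓡 3) ∞
      (fun m => mot (v m) (QuotientGroup.mk (slMk (a m) (b m) (c m) (d m) (h m))) • X m) := by
  obtain ⟨hn, hk⟩ := contMDiff_psi_iff.1 hX
  refine contMDiff_psi_iff.2 ?_
  simp only [normal_mot_smul, height_mot_smul, ad_slMk]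
  have := contMDiff_adFun ha hb hc hd hn
  exact ⟨this, hk.sub (contMDiff_form this hv)⟩

theorem contMDiff_mot_inv_smul {a b c d : M → ℝ} {h : ∀ m, a m * d m - b m * c m = 1} {v : M → V}
    {X : M → Psi} (ha : ContMDiff I 𝓘(ℝ, ℝ) ∞ a) (hb : ContMDiff I 𝓘(ℝ, ℝ) ∞ b)
    (hc : ContMDiff I 𝓘(ℝ, ℝ) ∞ c) (hd : ContMDiff I 𝓘(ℝ, ℝ) ∞ d)
    (hv : ∀ i, ContMDiff I 𝓘(ℝ, ℝ) ∞ (fun m => v m i)) (hX : ContMDiff I (𝓡 3) ∞ X) :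
    ContMDiff I (𝓡 3) ∞
      (fun m => (mot (v m) (QuotientGroup.mk (slMk (a m) (b m) (c m) (d m) (h m))))⁻¹ • X m) := by
  simp only [mot_inv, ← QuotientGroup.mk_inv, slMk_inv]
  refine contMDiff_mot_smul hd hb.neg hc.neg ha (fun i => ?_) hX
  simp only [Pi.neg_apply, ad_slMk]
  exact (contMDiff_adFun hd hb.neg hc.neg ha hv i).neg

theorem contMDiff_smul (g : G) {X : M → Psi} (hX : ContMDiff I (𝓡 3) ∞ X) :
    ContMDiff I (𝓡 3) ∞ (fun m => g • X m) := by
  obtain ⟨v, γ, rfl⟩ : ∃ v γ, g = mot v γ := ⟨_, _, (mot_eta g).symm⟩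
  induction γ using QuotientGroup.induction_on with
  | H A =>
    obtain ⟨a, b, c, d, h, rfl⟩ := exists_slMk A
    exact contMDiff_mot_smul contMDiff_const contMDiff_const contMDiff_const contMDiff_const
      (fun i => contMDiff_const) hX

theorem contMDiff_smul_comp {μ : Psi → Psi → G}
    (h : ContMDiff ((𝓡 3).prod ((𝓡 3).prod (𝓡 3))) (𝓡 3) ∞
      (fun q : Psi × Psi × Psi => μ q.1 q.2.1 • q.2.2)) {X Y Z : M → Psi}
    (hX : ContMDiff I (𝓡 3) ∞ X) (hY : ContMDiff I (𝓡 3) ∞ Y) (hZ : ContMDiff I (𝓡 3) ∞ Z) :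
    ContMDiff I (𝓡 3) ∞ (fun m => μ (X m) (Y m) • Z m) :=
  h.comp (hX.prodMk (hY.prodMk hZ))

end Smooth

/-! ### Sharply transitive sections and their loops -/

/-- `Θ` acts sharply transitively on `Ψ`. -/
def IsSharplyTransitive (Θ : Set G) : Prop :=
  ∀ D₁ D₂ : Psi, ∃! ρ : G, ρ ∈ Θ ∧ ρ • D₁ = D₂

/-- `Θ` has a smoothly varying element carrying one plane to another one. -/
def IsSmoothSection (Θ : Set G) : Prop :=
  ∃ μ : Psi → Psi → G, (∀ X Y, μ X Y ∈ Θ ∧ μ X Y • X = Y) ∧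
    ContMDiff ((𝓡 3).prod ((𝓡 3).prod (𝓡 3))) (𝓡 3) ∞
      (fun q : Psi × Psi × Psi => μ q.1 q.2.1 • q.2.2) ∧
    ContMDiff ((𝓡 3).prod ((𝓡 3).prod (𝓡 3))) (𝓡 3) ∞
      (fun q : Psi × Psi × Psi => (μ q.1 q.2.1)⁻¹ • q.2.2)

section Loop

variable {Θ : Set G}

theorem loopMul_eq (hΘ : IsSharplyTransitive Θ) {ρ : G} (hρ : ρ ∈ Θ) {Q X : Psi} (hX : ρ • Q = X)
    (Y : Psi) : loopMul Θ Q X Y = ρ • Y := by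
  have h := Classical.epsilon_spec (p := fun ρ : G => ρ ∈ Θ ∧ ρ • Q = X) ⟨ρ, hρ, hX⟩
  rw [loopMul, (hΘ Q X).unique h ⟨hρ, hX⟩]

theorem IsSharplyTransitive.exists_loopMul (hΘ : IsSharplyTransitive Θ) (Q X : Psi) :
    ∃ ρ ∈ Θ, ρ • Q = X ∧ ∀ Y, loopMul Θ Q X Y = ρ • Y := by
  obtain ⟨ρ, ⟨hρ, hX⟩, -⟩ := hΘ Q X
  exact ⟨ρ, hρ, hX, loopMul_eq hΘ hρ hX⟩

/-- Left division only inverts a left translation. Right division, `x * a = b`, needs sharp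
transitivity at the pair `(a, b)` and not merely at `Q`. -/
theorem IsSharplyTransitive.isLoop (hΘ : IsSharplyTransitive Θ) (h1 : (1 : G) ∈ Θ) (Q : Psi) :
    LoopTheory.IsLoop (loopMul Θ Q) Q where
  one_mul x := by rw [loopMul_eq hΘ h1 (one_smul G Q), one_smul]
  mul_one x := by
    obtain ⟨ρ, -, hX, h⟩ := hΘ.exists_loopMul Q x
    rw [h, hX]
  existsUnique_left a b := by
    obtain ⟨ρ, -, -, h⟩ := hΘ.exists_loopMul Q a
    simp only [h]
    exact ⟨ρ⁻¹ • b, smul_inv_smul ρ b, fun y hy => by rw [← hy, inv_smul_smul]⟩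
  existsUnique_right a b := by
    obtain ⟨ρ, ⟨hρ, hab⟩, hu⟩ := hΘ a b
    refine ⟨ρ • Q, (loopMul_eq hΘ hρ rfl a).trans hab, fun x hx => ?_⟩
    obtain ⟨τ, hτ, rfl, h⟩ := hΘ.exists_loopMul Q x
    rw [hu τ ⟨hτ, by rw [← h a]; exact hx⟩]

/-- With `μ X Y` the element of `Θ` carrying `X` to `Y`, the product is `μ Q X • Y`, left division
is `(μ Q a)⁻¹ • b` and right division is `μ a b • Q`. -/
theorem IsSharplyTransitive.isDifferentiableLoop (hΘ : IsSharplyTransitive Θ) (h1 : (1 : G) ∈ Θ)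
    (hs : IsSmoothSection Θ) (Q : Psi) :
    LoopTheory.IsDifferentiableLoop (𝓡 3) (loopMul Θ Q) Q := by
  obtain ⟨μ, hμ, hμ1, hμ2⟩ := hs
  have hl : ∀ X Y, loopMul Θ Q X Y = μ Q X • Y := fun X Y =>
    loopMul_eq hΘ (hμ Q X).1 (hμ Q X).2 Y
  refine ⟨hΘ.isLoop h1 Q, ?_, ⟨fun a b => (μ Q a)⁻¹ • b, fun a b => ?_,
    contMDiff_smul_comp (μ := fun X Y => (μ X Y)⁻¹) hμ2 contMDiff_const contMDiff_fst contMDiff_snd⟩,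
    ⟨fun b a => μ a b • Q, fun a b => ?_, ?_⟩⟩
  · simp only [hl]
    exact contMDiff_smul_comp hμ1 contMDiff_const contMDiff_fst contMDiff_snd
  · rw [hl, smul_inv_smul]
  · rw [loopMul_eq hΘ (hμ a b).1 rfl, (hμ a b).2]
  · exact contMDiff_smul_comp hμ1 contMDiff_snd contMDiff_fst contMDiff_const

/-- Conjugation by `g` carries the loop of `Θ` to the loop of `g Θ g⁻¹`. -/
theorem loopMul_smul {Θ' : Set G} (hΘ : IsSharplyTransitive Θ) (hΘ' : IsSharplyTransitive Θ')
    {g : G} (hg : ∀ ρ ∈ Θ, g * ρ * g⁻¹ ∈ Θ') (Q X Y : Psi) :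
    g • loopMul Θ Q X Y = loopMul Θ' (g • Q) (g • X) (g • Y) := by
  obtain ⟨ρ, hρ, rfl, h⟩ := hΘ.exists_loopMul Q X
  rw [h, loopMul_eq hΘ' (hg ρ hρ) (by simp [mul_smul])]
  simp [mul_smul]

/-- If the loop of `Θ` is Bol, then `Θ` is closed under `(ρ, σ) ↦ ρ σ ρ`. -/
theorem IsSharplyTransitive.mul_mem_of_isBol (hΘ : IsSharplyTransitive Θ) {Q : Psi}
    (h : LoopTheory.IsBol (loopMul Θ Q)) {ρ σ : G} (hρ : ρ ∈ Θ) (hσ : σ ∈ Θ) : ρ * σ * ρ ∈ Θ := by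
  obtain ⟨c, hc⟩ := h (ρ • Q) (σ • Q)
  obtain ⟨τ, hτ, -, hτc⟩ := hΘ.exists_loopMul Q c
  have : ρ * σ * ρ = τ := smul_faithful fun X => by
    rw [← hτc, ← hc, loopMul_eq hΘ hρ rfl, loopMul_eq hΘ hσ rfl, loopMul_eq hΘ hρ rfl, mul_smul,
      mul_smul]
  rwa [this]

theorem IsSharplyTransitive.conj (hΘ : IsSharplyTransitive Θ) {Θ' : Set G} {g : G}
    (hg : ∀ ρ, ρ ∈ Θ' ↔ g⁻¹ * ρ * g ∈ Θ) : IsSharplyTransitive Θ' := by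
  intro D₁ D₂
  obtain ⟨ρ, ⟨hρ, hD⟩, hu⟩ := hΘ (g⁻¹ • D₁) (g⁻¹ • D₂)
  refine ⟨g * ρ * g⁻¹, ⟨(hg _).2 (by group; simpa using hρ), ?_⟩, ?_⟩
  · rw [mul_smul, mul_smul, hD, smul_inv_smul]
  · rintro τ ⟨hτ, rfl⟩
    rw [← hu (g⁻¹ * τ * g) ⟨(hg τ).1 hτ, by simp [mul_smul]⟩]
    group

theorem IsSmoothSection.conj (hΘ : IsSmoothSection Θ) {Θ' : Set G} {g : G}
    (hg : ∀ ρ, ρ ∈ Θ' ↔ g⁻¹ * ρ * g ∈ Θ) : IsSmoothSection Θ' := by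
  obtain ⟨μ, hμ, h1, h2⟩ := hΘ
  have hX := contMDiff_smul (I := (𝓡 3).prod ((𝓡 3).prod (𝓡 3))) (M := Psi × Psi × Psi) g⁻¹
    contMDiff_fst
  have hY := contMDiff_smul (I := (𝓡 3).prod ((𝓡 3).prod (𝓡 3))) (M := Psi × Psi × Psi) g⁻¹
    (contMDiff_fst.comp contMDiff_snd)
  have hZ := contMDiff_smul (I := (𝓡 3).prod ((𝓡 3).prod (𝓡 3))) (M := Psi × Psi × Psi) g⁻¹
    (contMDiff_snd.comp contMDiff_snd)
  refine ⟨fun X Y => g * μ (g⁻¹ • X) (g⁻¹ • Y) * g⁻¹, fun X Y => ⟨(hg _).2 ?_, ?_⟩, ?_, ?_⟩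
  · group; simpa using (hμ _ _).1
  · rw [mul_smul, mul_smul, (hμ _ _).2, smul_inv_smul]
  · simp only [mul_smul]
    exact contMDiff_smul g (contMDiff_smul_comp h1 hX hY hZ)
  · simp only [mul_inv_rev, inv_inv, mul_smul]
    exact contMDiff_smul g (contMDiff_smul_comp (μ := fun X Y => (μ X Y)⁻¹) h2 hX hY hZ)

end Loop

/-! ### The sections `theta` -/

/-- The element of `theta basePlane (span w)` carrying `X` to `Y`. -/
noncomputable def thetaMove (w : V) (X Y : Psi) : G :=
  mot (((height X - height Y) / form (normal Y) w) • w) (QuotientGroup.mk (hypMove X Y))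

theorem thetaMove_mem (w : V) (X Y : Psi) :
    thetaMove w X Y ∈ theta basePlane (Submodule.span ℝ {w}) :=
  mem_theta_basePlane.2 ⟨_, Submodule.smul_mem _ _ (Submodule.mem_span_singleton_self w), _,
    hypMove_mem X Y, rfl⟩

theorem thetaMove_smul {w : V} (hw : ∀ X, form (normal X) w ≠ 0) (X Y : Psi) :
    thetaMove w X Y • X = Y := by
  refine psi_ext ?_ ?_
  · rw [thetaMove, normal_mot_smul, ad_hypMove]
  · rw [thetaMove, height_mot_smul, ad_hypMove, map_smul, smul_eq_mul, div_mul_cancel₀ _ (hw Y)]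
    ring

/-- The normals force the rotation part by `eq_hypMove`; the heights then give a linear equation for
the translation coefficient, solvable uniquely because `form (normal _) w ≠ 0`. -/
theorem eq_thetaMove {w : V} (hw : ∀ X, form (normal X) w ≠ 0) {X : Psi} {ρ : G}
    (hρ : ρ ∈ theta basePlane (Submodule.span ℝ {w})) : ρ = thetaMove w X (ρ • X) := by
  obtain ⟨v, hv, δ, hδ, rfl⟩ := mem_theta_basePlane.1 hρ
  obtain ⟨s, rfl⟩ := Submodule.mem_span_singleton.1 hv
  refine mot_inj.2 ⟨?_, eq_hypMove hδ (normal_mot_smul _ _ _).symm⟩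
  congr 1
  rw [eq_div_iff (hw _), height_mot_smul, normal_mot_smul, map_smul, smul_eq_mul]
  ring

theorem isSharplyTransitive_theta_basePlane {W : Submodule ℝ V} (hW : IsTransversal W) :
    IsSharplyTransitive (theta basePlane W) := by
  obtain ⟨w, rfl, hw⟩ := isTransversal_iff.1 hW
  refine fun X Y => ⟨_, ⟨thetaMove_mem w X Y, thetaMove_smul hw X Y⟩, ?_⟩
  rintro ρ ⟨hρ, rfl⟩
  exact eq_thetaMove hw hρ

theorem isSmoothSection_theta_basePlane {W : Submodule ℝ V} (hW : IsTransversal W) :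
    IsSmoothSection (theta basePlane W) := by
  obtain ⟨w, rfl, hw⟩ := isTransversal_iff.1 hW
  have h1 : ContMDiff ((𝓡 3).prod ((𝓡 3).prod (𝓡 3))) (𝓡 3) ∞
      (fun q : Psi × Psi × Psi => q.1) := contMDiff_fst
  have h2 : ContMDiff ((𝓡 3).prod ((𝓡 3).prod (𝓡 3))) (𝓡 3) ∞
      (fun q : Psi × Psi × Psi => q.2.1) := contMDiff_fst.comp contMDiff_snd
  have h3 : ContMDiff ((𝓡 3).prod ((𝓡 3).prod (𝓡 3))) (𝓡 3) ∞
      (fun q : Psi × Psi × Psi => q.2.2) := contMDiff_snd.comp contMDiff_snd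
  obtain ⟨n1, k1⟩ := contMDiff_psi_iff.1 h1
  obtain ⟨n2, k2⟩ := contMDiff_psi_iff.1 h2
  have hD := contMDiff_sqrt (f := fun q : Psi × Psi × Psi => hypDenSq q.1 q.2.1)
    (contMDiff_const.add (contMDiff_const.mul
      ((((n1 0).mul (n2 0)).add ((n1 1).mul (n2 1))).add ((n1 2).mul (n2 2)))))
    fun q => hypDenSq_pos _ _
  have hD0 : ∀ q : Psi × Psi × Psi, √(hypDenSq q.1 q.2.1) ≠ 0 := fun q => (hypDen_pos _ _).ne'
  have hp := ((((n1 2).add (n2 2)).add (n2 1)).sub (n1 1)).div₀ hD hD0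
  have hq := ((n1 0).sub (n2 0)).div₀ hD hD0
  have hr := ((((n1 2).add (n2 2)).sub (n2 1)).add (n1 1)).div₀ hD hD0
  have hs := (k1.sub k2).div₀ (contMDiff_form n2 fun _ => contMDiff_const (c := w _))
    fun q => hw q.2.1
  have hv := fun i => hs.mul (contMDiff_const (c := w i))
  exact ⟨thetaMove w, fun X Y => ⟨thetaMove_mem w X Y, thetaMove_smul hw X Y⟩,
    contMDiff_mot_smul hp hq hq hr hv h3, contMDiff_mot_inv_smul hp hq hq hr hv h3⟩

/-- Every section `theta P W` is conjugate to one with the base plane `z = 0`. -/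
theorem exists_theta_conj {P : Psi} (hP : (0 : V) ∈ P.1) {W : Submodule ℝ V}
    (hW : IsTransversal W) : ∃ γ W', rot γ • basePlane = P ∧ IsTransversal W' ∧
      W = W'.map (ad γ).toLinearMap ∧
      ∀ ρ, ρ ∈ theta P W ↔ (rot γ)⁻¹ * ρ * rot γ ∈ theta basePlane W' := by
  obtain ⟨γ, rfl⟩ := exists_rot_basePlane hP
  have h : W = (W.map (ad γ⁻¹).toLinearMap).map (ad γ).toLinearMap := by
    rw [map_map_ad, mul_inv_cancel, map_ad_one]
  refine ⟨γ, W.map (ad γ⁻¹).toLinearMap, rfl, isTransversal_map hW _, h, fun ρ => ?_⟩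
  rw [← mem_theta_conj, ← h]

theorem isSharplyTransitive_theta {P : Psi} (hP : (0 : V) ∈ P.1) {W : Submodule ℝ V}
    (hW : IsTransversal W) : IsSharplyTransitive (theta P W) := by
  obtain ⟨γ, W', -, hW', -, h⟩ := exists_theta_conj hP hW
  exact (isSharplyTransitive_theta_basePlane hW').conj h

theorem isSmoothSection_theta {P : Psi} (hP : (0 : V) ∈ P.1) {W : Submodule ℝ V}
    (hW : IsTransversal W) : IsSmoothSection (theta P W) := by
  obtain ⟨γ, W', -, hW', -, h⟩ := exists_theta_conj hP hW
  exact (isSmoothSection_theta_basePlane hW').conj h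

theorem one_mem_theta {P : Psi} (hP : (0 : V) ∈ P.1) (W : Submodule ℝ V) :
    (1 : G) ∈ theta P W := by
  obtain ⟨γ, hγ⟩ := exists_rot_basePlane hP
  refine ⟨1, ⟨0, W.zero_mem, by simp [transl]⟩, 1, ⟨γ, hγ, 1, one_mem_hypSectionStd, ?_⟩,
    (mul_one 1).symm⟩
  rw [mul_one, mul_inv_cancel, rot_eq, mot_one]

/-! ### Generation of `G` by the sections -/

/-- Each unipotent triangular matrix is a product of three positive definite ones, and unipotent
triangular matrices generate `SL₂(ℝ)`. -/
theorem closure_hypSectionStd : Subgroup.closure hypSectionStd = ⊤ := by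
  have hpd : ∀ p q r h, 0 < p → (QuotientGroup.mk (slMk p q q r h) : PSL2) ∈
      Subgroup.closure hypSectionStd := fun p q r h hp =>
    Subgroup.subset_closure ⟨_, posDef_slMk h hp, rfl⟩
  have hU : ∀ t h, (QuotientGroup.mk (slMk 1 t 0 1 h) : PSL2) ∈
      Subgroup.closure hypSectionStd := fun t h => by
    have h1 := hpd 2 0 (1 / 2) (by norm_num) (by norm_num)
    have h2 := hpd (1 / 2 + 2 * t ^ 2 / 9) (2 * t / 3) 2 (by ring) (by positivity)
    have h3 := hpd 1 (-t / 3) (1 + t ^ 2 / 9) (by ring) (by norm_num)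
    convert mul_mem (mul_mem h1 h2) h3 using 1
    rw [← QuotientGroup.mk_mul, ← QuotientGroup.mk_mul, slMk_mul, slMk_mul]
    congr 1
    apply slMk_congr <;> ring
  have hL : ∀ t h, (QuotientGroup.mk (slMk 1 0 t 1 h) : PSL2) ∈
      Subgroup.closure hypSectionStd := fun t h => by
    -- Transposition fixes the three symmetric factors and reverses their order.
    have h1 := hpd 2 0 (1 / 2) (by norm_num) (by norm_num)
    have h2 := hpd (1 / 2 + 2 * t ^ 2 / 9) (2 * t / 3) 2 (by ring) (by positivity)
    have h3 := hpd 1 (-t / 3) (1 + t ^ 2 / 9) (by ring) (by norm_num)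
    convert mul_mem (mul_mem h3 h2) h1 using 1
    rw [← QuotientGroup.mk_mul, ← QuotientGroup.mk_mul, slMk_mul, slMk_mul]
    congr 1
    apply slMk_congr <;> ring
  have hc : ∀ a b c d h, c ≠ 0 → (QuotientGroup.mk (slMk a b c d h) : PSL2) ∈
      Subgroup.closure hypSectionStd := fun a b c d h hc => by
    -- A matrix with `c ≠ 0` factors as upper, lower, upper unipotent.
    convert mul_mem (mul_mem (hU ((a - 1) / c) (by ring)) (hL c (by ring)))
      (hU ((d - 1) / c) (by ring)) using 1
    rw [← QuotientGroup.mk_mul, ← QuotientGroup.mk_mul, slMk_mul, slMk_mul]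
    congr 1
    apply slMk_congr <;> field_simp
    · ring
    · linear_combination -h
    · ring
    · ring
  refine eq_top_iff.2 fun γ _ => ?_
  induction γ using QuotientGroup.induction_on with
  | H A =>
    obtain ⟨a, b, c, d, h, rfl⟩ := exists_slMk A
    by_cases h0 : c = 0
    · subst h0
      have hd : d ≠ 0 := by rintro rfl; simp at h
      -- Adding the second column to the first makes the lower left entry `d ≠ 0`.
      convert mul_mem (hc (a + b) b d d (by linear_combination h) hd) (hL (-1) (by ring)) using 1
      rw [← QuotientGroup.mk_mul, slMk_mul]
      congr 1
      apply slMk_congr <;> ring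
    · exact hc _ _ _ _ h h0

/-- The half turn about the third axis. -/
noncomputable def halfTurn : PSL2 := QuotientGroup.mk (slMk 0 (-1) 1 0 (by norm_num))

theorem ad_halfTurn (v : V) : ad halfTurn v = ![-v 0, -v 1, v 2] := by
  rw [halfTurn, ad_slMk]
  ext i
  fin_cases i <;> simp [adFun]
  ring

/-- The boost `diag (2, 1/2)`. -/
noncomputable def boostDiag : PSL2 := QuotientGroup.mk (slMk 2 0 0 (1 / 2) (by norm_num))

theorem ad_boostDiag (v : V) : ad boostDiag v =
    ![v 0, 17 / 8 * v 1 + 15 / 8 * v 2, 15 / 8 * v 1 + 17 / 8 * v 2] := by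
  rw [boostDiag, ad_slMk]
  ext i
  fin_cases i <;> simp [adFun] <;> ring

theorem boostDiag_mem : boostDiag ∈ hypSectionStd := ⟨_, posDef_slMk _ (by norm_num), rfl⟩

noncomputable def boostOff : PSL2 :=
  QuotientGroup.mk (slMk (5 / 4) (3 / 4) (3 / 4) (5 / 4) (by norm_num))

theorem ad_boostOff (v : V) : ad boostOff v =
    ![17 / 8 * v 0 - 15 / 8 * v 2, v 1, -(15 / 8 * v 0) + 17 / 8 * v 2] := by
  rw [boostOff, ad_slMk]
  ext i
  fin_cases i <;> simp [adFun] <;> ring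

theorem boostOff_mem : boostOff ∈ hypSectionStd := ⟨_, posDef_slMk _ (by norm_num), rfl⟩

/-- An invariant subgroup of `ℝ³` containing a line off the plane `z = 0` is everything. -/
theorem addSubgroup_eq_top_of_line {T : AddSubgroup V} (hT : ∀ γ, ∀ v ∈ T, ad γ v ∈ T) {w : V}
    (hw : w 2 ≠ 0) (h : ∀ c : ℝ, c • w ∈ T) : T = ⊤ := by
  have hz : ∀ z : ℝ, ![0, 0, z] ∈ T := fun z => by
    -- A vector plus its image under the half turn is twice its component on the third axis.
    have h1 := h (z / (2 * w 2))
    convert add_mem h1 (hT halfTurn _ h1) using 1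
    rw [ad_halfTurn]
    ext i
    fin_cases i <;> simp
    field_simp
    norm_num
  have hy : ∀ y : ℝ, ![0, y, 0] ∈ T := fun y => by
    -- The boost tilts the axis towards the `y`-axis; subtracting a vector of the axis leaves the
    -- `y`-component. The other boost handles `x` in the same way.
    convert sub_mem (hT boostDiag _ (hz (8 / 15 * y))) (hz (17 / 15 * y)) using 1
    rw [ad_boostDiag]
    ext i
    fin_cases i <;> simp <;> ring
  have hx : ∀ x : ℝ, ![x, 0, 0] ∈ T := fun x => by
    convert sub_mem (hT boostOff _ (hz (-8 / 15 * x))) (hz (-17 / 15 * x)) using 1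
    rw [ad_boostOff]
    ext i
    fin_cases i <;> simp <;> ring
  refine eq_top_iff.2 fun v _ => ?_
  convert add_mem (add_mem (hx (v 0)) (hy (v 1))) (hz (v 2)) using 1
  ext i
  fin_cases i <;> simp

/-- An invariant subgroup of `ℝ³` containing the plane `z = 0` is everything. -/
theorem addSubgroup_eq_top_of_plane {T : AddSubgroup V} (hT : ∀ γ, ∀ v ∈ T, ad γ v ∈ T)
    (h : ∀ v : V, v 2 = 0 → v ∈ T) : T = ⊤ := by
  refine addSubgroup_eq_top_of_line hT (w := ![0, 0, 1]) (by simp) fun c => ?_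
  convert sub_mem (hT boostDiag _ (h ![0, 8 / 15 * c, 0] rfl)) (h ![0, 17 / 15 * c, 0] rfl) using 1
  rw [ad_boostDiag]
  ext i
  fin_cases i <;> simp <;> ring

theorem transl_add (v w : V) : transl (v + w) = transl v * transl w := by
  simp [transl_eq, mot_mul]

theorem transl_zero : transl 0 = 1 := by rw [transl_eq, mot_one]

theorem transl_neg (v : V) : transl (-v) = (transl v)⁻¹ := by
  simp [transl_eq, mot_inv]

/-- The vectors of the translations in a subgroup of `G`. -/
def translVectors (H : Subgroup G) : AddSubgroup V where
  carrier := {v | transl v ∈ H}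
  add_mem' := fun {v w} (hv : transl v ∈ H) (hw : transl w ∈ H) =>
    show transl (v + w) ∈ H from transl_add v w ▸ mul_mem hv hw
  zero_mem' := show transl 0 ∈ H from transl_zero ▸ one_mem H
  neg_mem' := fun {v} (hv : transl v ∈ H) => show transl (-v) ∈ H from transl_neg v ▸ inv_mem hv

theorem mem_translVectors {H : Subgroup G} {v : V} : v ∈ translVectors H ↔ transl v ∈ H := Iff.rfl

theorem exists_eq_span_of_isTransversal {W : Submodule ℝ V} (hW : IsTransversal W) :
    ∃ w, W = Submodule.span ℝ {w} ∧ w 2 ≠ 0 := by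
  obtain ⟨w, rfl, hw⟩ := isTransversal_iff.1 hW
  refine ⟨w, rfl, ?_⟩
  have := hw basePlane
  rw [basePlane_normal.1] at this
  simpa [form_apply] using this

theorem closure_theta_basePlane {W : Submodule ℝ V} (hW : IsTransversal W) :
    Subgroup.closure (theta basePlane W) = ⊤ := by
  obtain ⟨w, rfl, hw⟩ := exists_eq_span_of_isTransversal hW
  have hrot : ∀ γ, rot γ ∈ Subgroup.closure (theta basePlane (Submodule.span ℝ {w})) := by
    have : Subgroup.closure hypSectionStd ≤
        (Subgroup.closure (theta basePlane (Submodule.span ℝ {w}))).comap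
          (SemidirectProduct.inr : PSL2 →* G) :=
      (Subgroup.closure_le _).2 fun δ hδ => Subgroup.subset_closure (rot_mem_theta _ hδ)
    rw [closure_hypSectionStd] at this
    exact fun γ => this (Subgroup.mem_top γ)
  have hT : translVectors (Subgroup.closure (theta basePlane (Submodule.span ℝ {w}))) = ⊤ := by
    refine addSubgroup_eq_top_of_line (fun γ v hv => ?_) hw fun c => ?_
    · rw [mem_translVectors] at hv ⊢
      rw [← rot_conj_transl]
      exact mul_mem (mul_mem (hrot γ) hv) (inv_mem (hrot γ))
    · exact Subgroup.subset_closure (transl_mem_theta (Submodule.smul_mem _ _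
        (Submodule.mem_span_singleton_self w)))
  refine eq_top_iff.2 fun g _ => ?_
  rw [← mot_eta g]
  exact mul_mem (mem_translVectors.1 (hT ▸ AddSubgroup.mem_top _)) (hrot _)

theorem closure_theta {P : Psi} (hP : (0 : V) ∈ P.1) {W : Submodule ℝ V} (hW : IsTransversal W) :
    Subgroup.closure (theta P W) = ⊤ := by
  obtain ⟨γ, W', -, hW', -, h⟩ := exists_theta_conj hP hW
  have hle : Subgroup.closure (theta basePlane W') ≤
      (Subgroup.closure (theta P W)).comap (MulAut.conj (rot γ)).toMonoidHom :=
    (Subgroup.closure_le _).2 fun ρ hρ => Subgroup.subset_closure ((h _).2 (by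
      change (rot γ)⁻¹ * (rot γ * ρ * (rot γ)⁻¹) * rot γ ∈ theta basePlane W'
      convert hρ using 1
      group))
  rw [closure_theta_basePlane hW'] at hle
  refine eq_top_iff.2 fun g _ => ?_
  have := hle (Subgroup.mem_top ((rot γ)⁻¹ * g * rot γ))
  change rot γ * ((rot γ)⁻¹ * g * rot γ) * (rot γ)⁻¹ ∈ Subgroup.closure (theta P W) at this
  convert this using 1
  group

/-! ### The Bol condition -/

/-- For a translation by `w` and a rotation part `δ`, the product `ρ σ ρ` has translation part `w +
δ w`. If it lay in `Θ`, then `w` would be an eigenvector of every `δ` in the section, and two boosts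
with different axes have no common eigenvector off the plane `z = 0`. -/
theorem not_isBol_basePlane {W : Submodule ℝ V} (hW : IsTransversal W) :
    ¬ ∀ ρ ∈ theta basePlane W, ∀ σ ∈ theta basePlane W, ρ * σ * ρ ∈ theta basePlane W := by
  intro H
  obtain ⟨w, rfl, hw⟩ := exists_eq_span_of_isTransversal hW
  have key : ∀ δ ∈ hypSectionStd, ∃ c : ℝ, c • w = ad δ w := fun δ hδ => by
    have hww := Submodule.mem_span_singleton_self (R := ℝ) w
    have h := H _ (transl_mem_theta hww) _ (rot_mem_theta _ hδ)
    obtain ⟨v, hv, δ', -, e⟩ := mem_theta_basePlane.1 h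
    rw [transl_eq, rot_eq, mot_mul, mot_mul, mot_inj, map_zero, add_zero, one_mul] at e
    refine Submodule.mem_span_singleton.1 ?_
    have : ad δ w = v - w := by rw [← e.1]; abel
    rw [this]
    exact sub_mem hv hww
  obtain ⟨c, hc⟩ := key _ boostDiag_mem
  obtain ⟨d, hd⟩ := key _ boostOff_mem
  rw [ad_boostDiag] at hc
  rw [ad_boostOff] at hd
  have c0 := congrFun hc 0
  have c1 := congrFun hc 1
  have c2 := congrFun hc 2
  have d0 := congrFun hd 0
  have d1 := congrFun hd 1
  have d2 := congrFun hd 2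
  simp at c0 c1 c2 d0 d1 d2
  have h0 : w 0 = 0 := by
    -- The boost fixes the `x`-coordinate, so the eigenvalue would be 1; but its fixed vectors have
    -- `z = 0`.
    by_contra h0
    have hc1 : c = 1 := by simpa [h0] using c0
    subst hc1
    exact hw (by linarith)
  have h1 : w 1 = 0 := by
    by_contra h1
    have hd1 : d = 1 := by simpa [h1] using d1
    subst hd1
    exact hw (by linarith)
  rw [h1] at c1
  exact hw (by linarith)

theorem not_isBol {P : Psi} (hP : (0 : V) ∈ P.1) {W : Submodule ℝ V} (hW : IsTransversal W)
    (Q : Psi) : ¬ LoopTheory.IsBol (loopMul (theta P W) Q) := by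
  intro hB
  obtain ⟨γ, W', -, hW', -, h⟩ := exists_theta_conj hP hW
  refine not_isBol_basePlane hW' fun ρ hρ σ hσ => ?_
  have hmem : ∀ τ ∈ theta basePlane W', rot γ * τ * (rot γ)⁻¹ ∈ theta P W := fun τ hτ =>
    (h _).2 (by convert hτ using 1; group)
  have := (h _).1 ((isSharplyTransitive_theta hP hW).mul_mem_of_isBol hB (hmem ρ hρ) (hmem σ hσ))
  convert this using 1
  group

/-! ### Rotations about the third axis -/

theorem exists_rotation {c s : ℝ} (h : c ^ 2 + s ^ 2 = 1) :
    ∃ γ : PSL2, ∀ v, ad γ v = ![c * v 0 - s * v 1, s * v 0 + c * v 1, v 2] := by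
  -- The adjoint action doubles angles, so the half angle is a complex square root of `c + s i`.
  obtain ⟨w, hw⟩ := IsAlgClosed.exists_eq_mul_self (⟨c, s⟩ : ℂ)
  have h1 : c = w.re * w.re - w.im * w.im := congrArg Complex.re hw
  have h2 : s = w.re * w.im + w.im * w.re := congrArg Complex.im hw
  have h3 : w.re * w.re - -w.im * w.im = 1 := by
    have : (w.re * w.re + w.im * w.im) ^ 2 = 1 := by rw [← h, h1, h2]; ring
    have := (pow_eq_one_iff_of_nonneg (by nlinarith [mul_self_nonneg w.re, mul_self_nonneg w.im])
      two_ne_zero).1 this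
    linarith
  refine ⟨QuotientGroup.mk (slMk w.re (-w.im) w.im w.re h3), fun v => ?_⟩
  rw [ad_slMk, h1, h2]
  ext i
  fin_cases i <;> simp [adFun]
  · ring
  · ring
  · linear_combination v 2 * h3

/-- The sign ambiguity of the square root disappears in `PSL₂(ℝ)`: faithfulness of `ad` makes
arbitrary choices multiplicative. -/
theorem exists_rotC : ∃ r : Circle →* PSL2, ∀ z v, ad (r z) v =
    ![(z : ℂ).re * v 0 - (z : ℂ).im * v 1, (z : ℂ).im * v 0 + (z : ℂ).re * v 1, v 2] := by
  have h : ∀ z : Circle, ∃ γ : PSL2, ∀ v, ad γ v =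
      ![(z : ℂ).re * v 0 - (z : ℂ).im * v 1, (z : ℂ).im * v 0 + (z : ℂ).re * v 1, v 2] := by
    intro z
    apply exists_rotation
    have := Circle.normSq_coe z
    rw [Complex.normSq_apply] at this
    linarith
  choose r hr using h
  refine ⟨MonoidHom.mk' r fun z w => ad_ext fun v => ?_, hr⟩
  rw [ad_mul_apply, hr, hr, hr]
  ext i
  fin_cases i <;> simp <;> ring

/-- The rotations about the third axis, parametrized by the unit circle. -/
noncomputable def rotC : Circle →* PSL2 := exists_rotC.choose

theorem ad_rotC (z : Circle) (v : V) : ad (rotC z) v =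
    ![(z : ℂ).re * v 0 - (z : ℂ).im * v 1, (z : ℂ).im * v 0 + (z : ℂ).re * v 1, v 2] :=
  exists_rotC.choose_spec z v

theorem rotC_injective : Function.Injective rotC := by
  intro z w h
  have h1 := ad_rotC z ![1, 0, 0]
  rw [h, ad_rotC] at h1
  have h0 := congrFun h1 0
  have h1 := congrFun h1 1
  simp at h0 h1
  exact Subtype.ext (Complex.ext h0.symm h1.symm)

theorem rotC_smul_basePlane (z : Circle) : rot (rotC z) • basePlane = basePlane := by
  rw [rot_smul_basePlane, ad_rotC]
  simp

theorem exists_rotC_of_stabilizer {γ : PSL2} (h : rot γ • basePlane = basePlane) :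
    ∃ z, rotC z = γ := by
  obtain ⟨a, b, hab, rfl⟩ := exists_slMk_of_stabilizer h
  have hn : ‖(⟨a ^ 2 - b ^ 2, 2 * a * b⟩ : ℂ)‖ = 1 := by
    rw [Complex.norm_def, Real.sqrt_eq_one, Complex.normSq_apply]
    linear_combination (a * a + b * b + 1) * hab
  obtain ⟨z, hz⟩ : ∃ z : Circle, (z : ℂ) = ⟨a ^ 2 - b ^ 2, 2 * a * b⟩ :=
    ⟨⟨_, mem_sphere_zero_iff_norm.2 hn⟩, rfl⟩
  refine ⟨z, ad_ext fun v => ?_⟩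
  rw [ad_rotC, ad_slMk, hz]
  ext i
  fin_cases i <;> simp [adFun]
  · ring
  · ring
  · linear_combination -v 2 * hab

theorem contMDiff_rotC_smul : ContMDiff ((𝓡 1).prod (𝓡 3)) (𝓡 3) ∞
    (fun q : Circle × Psi => rot (rotC q.1) • q.2) := by
  have hc : ContMDiff (𝓡 1) 𝓘(ℝ, ℂ) ∞ (fun z : Circle => (z : ℂ)) := by
    have := finrank_real_complex_fact'
    exact contMDiff_coe_sphere
  have hre : ContMDiff ((𝓡 1).prod (𝓡 3)) 𝓘(ℝ, ℝ) ∞ (fun q : Circle × Psi => (q.1 : ℂ).re) :=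
    Complex.reCLM.contDiff.contMDiff.comp (hc.comp contMDiff_fst)
  have him : ContMDiff ((𝓡 1).prod (𝓡 3)) 𝓘(ℝ, ℝ) ∞ (fun q : Circle × Psi => (q.1 : ℂ).im) :=
    Complex.imCLM.contDiff.contMDiff.comp (hc.comp contMDiff_fst)
  obtain ⟨hn, hk⟩ := contMDiff_psi_iff.1
    (contMDiff_snd (I := 𝓡 1) (J := 𝓡 3) (M := Circle) (N := Psi) (n := ∞))
  refine contMDiff_psi_iff.2 ?_
  simp only [normal_rot_smul, height_rot_smul, ad_rotC]
  refine ⟨fun i => ?_, hk⟩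
  fin_cases i
  exacts [(hre.mul (hn 0)).sub (him.mul (hn 1)), (him.mul (hn 0)).add (hre.mul (hn 1)), hn 2]

/-! ### The image of `G` in the homeomorphism group is closed -/

theorem continuous_normal (i : Fin 3) : Continuous fun X => normal X i :=
  ((contMDiff_psi_iff.1 (contMDiff_id (I := 𝓡 3) (M := Psi) (n := ∞))).1 i).continuous

theorem continuous_height : Continuous height :=
  (contMDiff_psi_iff.1 (contMDiff_id (I := 𝓡 3) (M := Psi) (n := ∞))).2.continuous

/-- The action of `G` on `Ψ` by homeomorphisms. -/
noncomputable def actHom : G →* (Psi ≃ₜ Psi) where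
  toFun g :=
    { toEquiv := MulAction.toPerm g
      continuous_toFun := (contMDiff_smul g (contMDiff_id (I := 𝓡 3) (n := ∞))).continuous
      continuous_invFun := (contMDiff_smul g⁻¹ (contMDiff_id (I := 𝓡 3) (n := ∞))).continuous }
  map_one' := by ext1 X; exact one_smul G X
  map_mul' g h := by ext1 X; exact mul_smul g h X

theorem actHom_apply (g : G) (X : Psi) : actHom g X = g • X := rfl

theorem actHom_injective : Function.Injective actHom := fun _ _ h =>
  smul_faithful fun X => DFunLike.congr_fun h X

/-- The determinant of three vectors. -/
def triple (u v w : V) : ℝ :=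
  u 0 * (v 1 * w 2 - v 2 * w 1) - u 1 * (v 0 * w 2 - v 2 * w 0) + u 2 * (v 0 * w 1 - v 1 * w 0)

theorem triple_ad (γ : PSL2) (u v w : V) : triple (ad γ u) (ad γ v) (ad γ w) = triple u v w := by
  induction γ using QuotientGroup.induction_on with
  | H A =>
    obtain ⟨a, b, c, d, h, rfl⟩ := exists_slMk A
    have e : triple (adFun a b c d u) (adFun a b c d v) (adFun a b c d w)
        = (a * d - b * c) ^ 3 * triple u v w := by
      simp only [triple, adFun, Matrix.cons_val_zero, Matrix.cons_val_one, Matrix.cons_val]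
      ring
    rw [ad_slMk, ad_slMk, ad_slMk, e, h, one_pow, one_mul]

/-- Properties of the transformations induced by `G`, preserved by pointwise limits, that
characterize these transformations. -/
structure IsMotionLike (f : Psi → Psi) : Prop where
  form_eq : ∀ X Y, form (normal (f X)) (normal (f Y)) = form (normal X) (normal Y)
  triple_eq : ∀ X Y Z, triple (normal (f X)) (normal (f Y)) (normal (f Z)) =
    triple (normal X) (normal Y) (normal Z)
  height_eq : ∀ (X X₁ X₂ X₃ : Psi) (a b c : ℝ),
    normal X = a • normal X₁ + b • normal X₂ + c • normal X₃ →
    height (f X) - height X = a * (height (f X₁) - height X₁) + b * (height (f X₂) - height X₂)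
      + c * (height (f X₃) - height X₃)

theorem isMotionLike_smul (g : G) : IsMotionLike fun X => g • X where
  form_eq X Y := by rw [normal_smul, normal_smul, form_ad_ad]
  triple_eq X Y Z := by rw [normal_smul, normal_smul, normal_smul, triple_ad]
  height_eq X X₁ X₂ X₃ a b c h := by
    simp only [height_smul, normal_smul, h, map_add, map_smul, LinearMap.add_apply,
      LinearMap.smul_apply, smul_eq_mul]
    ring

/-- Evaluation at a point is continuous for the compact-open topology, so each of the defining
identities is a closed condition. -/
theorem isMotionLike_of_mem_closure {S : Set C(Psi, Psi)} (hS : ∀ F ∈ S, IsMotionLike F)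
    {f : C(Psi, Psi)} (hf : f ∈ closure S) : IsMotionLike f := by
  have key : ∀ φ ψ : C(Psi, Psi) → ℝ, Continuous φ → Continuous ψ → (∀ F ∈ S, φ F = ψ F) →
      φ f = ψ f := fun φ ψ hφ hψ h =>
    closure_minimal (t := {F | φ F = ψ F}) h (isClosed_eq hφ hψ) hf
  have hn : ∀ X i, Continuous fun F : C(Psi, Psi) => normal (F X) i := fun X i =>
    (continuous_normal i).comp (ContinuousEvalConst.continuous_eval_const X)
  have hh : ∀ X, Continuous fun F : C(Psi, Psi) => height (F X) := fun X =>
    continuous_height.comp (ContinuousEvalConst.continuous_eval_const X)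
  constructor
  · intro X Y
    refine key (fun F => form (normal (F X)) (normal (F Y))) (fun _ => _) ?_ continuous_const
      fun F hF => (hS F hF).form_eq X Y
    exact (((hn X 0).mul (hn Y 0)).add ((hn X 1).mul (hn Y 1))).sub ((hn X 2).mul (hn Y 2))
  · intro X Y Z
    refine key (fun F => triple (normal (F X)) (normal (F Y)) (normal (F Z))) (fun _ => _) ?_
      continuous_const fun F hF => (hS F hF).triple_eq X Y Z
    exact (((hn X 0).mul (((hn Y 1).mul (hn Z 2)).sub ((hn Y 2).mul (hn Z 1)))).sub
      ((hn X 1).mul (((hn Y 0).mul (hn Z 2)).sub ((hn Y 2).mul (hn Z 0))))).add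
      ((hn X 2).mul (((hn Y 0).mul (hn Z 1)).sub ((hn Y 1).mul (hn Z 0))))
  · intro X X₁ X₂ X₃ a b c h
    refine key (fun F => height (F X) - height X) (fun F => a * (height (F X₁) - height X₁) +
      b * (height (F X₂) - height X₂) + c * (height (F X₃) - height X₃))
      ((hh X).sub continuous_const) ?_ fun F hF => (hS F hF).height_eq X X₁ X₂ X₃ a b c h
    exact ((continuous_const.mul ((hh X₁).sub continuous_const)).add
      (continuous_const.mul ((hh X₂).sub continuous_const))).add
      (continuous_const.mul ((hh X₃).sub continuous_const))

theorem exists_normal_combination {X₁ X₂ X₃ : Psi} (h₁ : normal X₁ = ![0, 0, 1])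
    (h₂ : normal X₂ = ![3 / 4, 0, 5 / 4]) (h₃ : normal X₃ = ![0, 3 / 4, 5 / 4]) (v : V) :
    ∃ a b c : ℝ, v = a • normal X₁ + b • normal X₂ + c • normal X₃ := by
  refine ⟨v 2 - 5 / 3 * (v 0 + v 1), 4 / 3 * v 0, 4 / 3 * v 1, ?_⟩
  rw [h₁, h₂, h₃]
  ext i
  fin_cases i <;> simp <;> ring

/-- Match the images of three basis normals successively: `σ` fits the first, a rotation `κ` about
it fits the second, and the third is then forced. The triple product is needed here to exclude a
reflection. The change of height is linear in the normal, hence represented by a vector, which gives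
the translation. -/
theorem IsMotionLike.exists_smul {f : Psi → Psi} (hf : IsMotionLike f) : ∃ g : G, ∀ X, f X = g • X := by
  obtain ⟨X₁, X₂, X₃, h₁, h₂, h₃⟩ := exists_normal_base
  obtain ⟨σ, hσ⟩ : ∃ σ : PSL2, ad σ (normal X₁) = normal (f X₁) := ⟨_, ad_hypMove _ _⟩
  have hform : ∀ X Y, form (ad σ⁻¹ (normal (f X))) (ad σ⁻¹ (normal (f Y))) =
      form (normal X) (normal Y) := fun X Y => by rw [form_ad_ad, hf.form_eq]
  have hm₁ : ad σ⁻¹ (normal (f X₁)) = normal X₁ := by rw [← hσ, ad_inv_apply_self]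
  have htriple : triple (ad σ⁻¹ (normal (f X₁))) (ad σ⁻¹ (normal (f X₂)))
      (ad σ⁻¹ (normal (f X₃))) = triple (normal X₁) (normal X₂) (normal X₃) := by
    rw [triple_ad, hf.triple_eq]
  obtain ⟨m₂, hm₂⟩ : ∃ m, m = ad σ⁻¹ (normal (f X₂)) := ⟨_, rfl⟩
  have e12 := hform X₁ X₂
  have e22 := hform X₂ X₂
  rw [hm₁, ← hm₂, h₁, h₂] at e12
  rw [← hm₂, h₂] at e22
  simp [form_apply] at e12 e22
  -- The preserved products give `m₂` third coordinate `5 / 4`, and put its first two coordinates on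
  -- the circle of radius `3 / 4`.
  obtain ⟨κ, hκ⟩ := exists_rotation (c := 4 / 3 * m₂ 0) (s := 4 / 3 * m₂ 1) (by
    rw [e12] at e22
    linear_combination 16 / 9 * e22)
  have hκ₁ : ad κ (normal X₁) = normal X₁ := by rw [hκ, h₁]; simp
  have hκ₂ : ad κ (normal X₂) = m₂ := by
    rw [hκ, h₂]
    ext i
    fin_cases i <;> simp [e12] <;> ring
  obtain ⟨l₃, hl₃⟩ : ∃ l, l = ad κ⁻¹ (ad σ⁻¹ (normal (f X₃))) := ⟨_, rfl⟩
  have hm₃ : ad σ⁻¹ (normal (f X₃)) = ad κ l₃ := by rw [hl₃, ad_apply_inv_self]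
  have e13 := hform X₁ X₃
  have e23 := hform X₂ X₃
  rw [hm₁, hm₃, ← hκ₁, form_ad_ad, hκ₁, h₁, h₃] at e13
  rw [← hm₂, hm₃, ← hκ₂, form_ad_ad, h₂, h₃] at e23
  rw [hm₁, ← hm₂, hm₃, ← hκ₂, ← hκ₁, triple_ad, hκ₁, h₁, h₂, h₃] at htriple
  simp [form_apply] at e13 e23
  simp [triple] at htriple
  -- `e13`, `e23` and `htriple` determine the third, first and second coordinate in turn.
  have hl : l₃ = normal X₃ := by
    rw [h₃]
    ext i
    fin_cases i <;> simp <;> linarith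
  have hγ : ∀ X, normal (f X) = ad (σ * κ) (normal X) := by
    have hγ₁ : normal (f X₁) = ad (σ * κ) (normal X₁) := by rw [ad_mul_apply, hκ₁, hσ]
    have hγ₂ : normal (f X₂) = ad (σ * κ) (normal X₂) := by
      rw [ad_mul_apply, hκ₂, hm₂, ad_apply_inv_self]
    have hγ₃ : normal (f X₃) = ad (σ * κ) (normal X₃) := by
      rw [ad_mul_apply, ← hl, ← hm₃, ad_apply_inv_self]
    intro X
    rw [← ad_apply_inv_self (σ * κ) (normal (f X))]
    congr 1
    have key : ∀ Y, normal (f Y) = ad (σ * κ) (normal Y) →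
        form (normal Y) (ad (σ * κ)⁻¹ (normal (f X)) - normal X) = 0 := fun Y hY => by
      rw [map_sub, ← form_ad_left, ← hY, hf.form_eq, sub_self]
    exact sub_eq_zero.1 (eq_zero_of_form_eq_zero (h₁ ▸ key X₁ hγ₁) (h₂ ▸ key X₂ hγ₂)
      (h₃ ▸ key X₃ hγ₃))
  obtain ⟨u, hu₁, hu₂, hu₃⟩ : ∃ u : V, form (normal X₁) u = height X₁ - height (f X₁) ∧
      form (normal X₂) u = height X₂ - height (f X₂) ∧
      form (normal X₃) u = height X₃ - height (f X₃) := by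
    refine ⟨![4 / 3 * (height X₂ - height (f X₂)) - 5 / 3 * (height X₁ - height (f X₁)),
      4 / 3 * (height X₃ - height (f X₃)) - 5 / 3 * (height X₁ - height (f X₁)),
      -(height X₁ - height (f X₁))], ?_, ?_, ?_⟩
    all_goals simp [form_apply, h₁, h₂, h₃]
    all_goals ring
  refine ⟨mot (ad (σ * κ) u) (σ * κ), fun X => psi_ext ?_ ?_⟩
  · rw [normal_mot_smul, hγ]
  · obtain ⟨a, b, c, habc⟩ := exists_normal_combination h₁ h₂ h₃ (normal X)
    have := hf.height_eq X X₁ X₂ X₃ a b c habc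
    rw [height_mot_smul, form_ad_ad, habc]
    simp only [map_add, map_smul, LinearMap.add_apply, LinearMap.smul_apply, smul_eq_mul,
      hu₁, hu₂, hu₃]
    linarith

section

variable {Θ : Set G}

theorem leftTranslations_loopMul (hΘ : IsSharplyTransitive Θ) (Q : Psi) :
    LoopTheory.leftTranslations (loopMul Θ Q) = actHom '' Θ := by
  ext f
  constructor
  · rintro ⟨a, ha⟩
    obtain ⟨ρ, hρ, -, h⟩ := hΘ.exists_loopMul Q a
    exact ⟨ρ, hρ, Homeomorph.ext fun X => by rw [ha, h, actHom_apply]⟩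
  · rintro ⟨ρ, hρ, rfl⟩
    exact ⟨ρ • Q, fun Y => (loopMul_eq hΘ hρ rfl Y).symm⟩

theorem closure_leftTranslations (hΘ : IsSharplyTransitive Θ) (hc : Subgroup.closure Θ = ⊤)
    (Q : Psi) : Subgroup.closure (LoopTheory.leftTranslations (loopMul Θ Q)) = actHom.range := by
  rw [leftTranslations_loopMul hΘ, ← MonoidHom.map_closure, hc, MonoidHom.range_eq_map]

theorem topologicallyGenerated_leftTranslations (hΘ : IsSharplyTransitive Θ)
    (hc : Subgroup.closure Θ = ⊤) (Q : Psi) :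
    LoopTheory.topologicallyGenerated (LoopTheory.leftTranslations (loopMul Θ Q)) =
      Set.range actHom := by
  rw [LoopTheory.topologicallyGenerated, closure_leftTranslations hΘ hc]
  ext f
  constructor
  · intro hf
    obtain ⟨g, hg⟩ := (isMotionLike_of_mem_closure (by
      rintro _ ⟨_, ⟨g, rfl⟩, rfl⟩
      exact isMotionLike_smul g) hf).exists_smul
    exact ⟨g, Homeomorph.ext fun X => (hg X).symm⟩
  · rintro ⟨g, rfl⟩
    exact subset_closure ⟨_, ⟨g, rfl⟩, rfl⟩

end

/-! ### Isomorphisms between the loops -/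

/-- Conjugation by `f` sends the left translations by elements of `Θ` to those of `Θ'`. As `Θ`
generates `G`, it sends all of `G` into `G`, and faithfulness makes the result a homomorphism. -/
theorem exists_hom_of_isIsomorphism {Θ Θ' : Set G} (hΘ : IsSharplyTransitive Θ)
    (hΘ' : IsSharplyTransitive Θ') (hc : Subgroup.closure Θ = ⊤) {Q : Psi} {f : Psi ≃ Psi}
    (hf : LoopTheory.IsIsomorphism (loopMul Θ Q) (loopMul Θ' Q) f) :
    ∃ α : G →* G, (∀ g X, f (g • X) = α g • f X) ∧ ∀ ρ ∈ Θ, α ρ ∈ Θ' := by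
  have hρ : ∀ ρ ∈ Θ, ∃ ρ' ∈ Θ', ∀ X, f (ρ • X) = ρ' • f X := fun ρ hρ => by
    obtain ⟨ρ', hρ', -, h⟩ := hΘ'.exists_loopMul Q (f (ρ • Q))
    exact ⟨ρ', hρ', fun X => by rw [← h, ← hf, loopMul_eq hΘ hρ rfl]⟩
  have hex : ∀ g : G, ∃ g' : G, ∀ X, f (g • X) = g' • f X := fun g => by
    have hg : g ∈ Subgroup.closure Θ := hc ▸ Subgroup.mem_top g
    induction hg using Subgroup.closure_induction with
    | mem ρ h =>
      obtain ⟨ρ', -, h⟩ := hρ ρ h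
      exact ⟨ρ', h⟩
    | one => exact ⟨1, fun X => by rw [one_smul, one_smul]⟩
    | mul g h _ _ hg hh =>
      obtain ⟨g', hg⟩ := hg
      obtain ⟨h', hh⟩ := hh
      exact ⟨g' * h', fun X => by rw [mul_smul, hg, hh, mul_smul]⟩
    | inv g _ hg =>
      obtain ⟨g', hg⟩ := hg
      exact ⟨g'⁻¹, fun X => by rw [eq_inv_smul_iff, ← hg, smul_inv_smul]⟩
  choose α hα using hex
  have huniq : ∀ g g', (∀ X, f (g • X) = g' • f X) → α g = g' := fun g g' h =>
    smul_faithful fun X => by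
      obtain ⟨Y, rfl⟩ := f.surjective X
      rw [← hα, h]
  refine ⟨MonoidHom.mk' α fun g h => huniq _ _ fun X => ?_, hα, fun ρ h => ?_⟩
  · rw [mul_smul, hα, hα, mul_smul]
  · obtain ⟨ρ', hρ', h⟩ := hρ ρ h
    change α ρ ∈ Θ'
    rwa [huniq ρ ρ' h]

theorem rot_right_smul_of_smul_basePlane {g : G} (h : g • basePlane = basePlane) :
    rot g.right • basePlane = basePlane := by
  rw [rot_smul_basePlane, ← basePlane_normal.1, ← normal_smul, h]

theorem stabilizer_comm {γ δ : PSL2} (hγ : rot γ • basePlane = basePlane)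
    (hδ : rot δ • basePlane = basePlane) : γ * δ = δ * γ := by
  obtain ⟨z, rfl⟩ := exists_rotC_of_stabilizer hγ
  obtain ⟨w, rfl⟩ := exists_rotC_of_stabilizer hδ
  rw [← map_mul, ← map_mul, mul_comm]

theorem rot_halfTurn_smul : rot halfTurn • basePlane = basePlane := by
  rw [rot_smul_basePlane, ad_halfTurn]
  simp

theorem transl_smul_basePlane {v : V} (hv : v 2 = 0) : transl v • basePlane = basePlane := by
  rw [transl_eq]
  refine psi_ext ?_ ?_
  · rw [normal_mot_smul, map_one]; rfl
  · rw [height_mot_smul, map_one, basePlane_normal.1]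
    simp [form_apply, hv]

/-- A translation along the plane `z = 0` is a commutator in the stabilizer of this plane. -/
theorem transl_eq_commutator {v : V} (hv : v 2 = 0) :
    transl v = transl ((1 / 2 : ℝ) • v) * rot halfTurn *
      (transl ((1 / 2 : ℝ) • v))⁻¹ * (rot halfTurn)⁻¹ := by
  rw [mul_assoc, mul_assoc, ← mul_assoc (rot halfTurn), ← transl_neg,
    rot_conj_transl, ← transl_add, ad_halfTurn]
  congr 1
  ext i
  fin_cases i <;> simp [hv] <;> ring

/-- Rotation parts of stabilizer elements commute, so `α` followed by projection to `PSL₂(ℝ)` kills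
the commutators of the stabilizer, among them all translations along the plane. The kernel is
normal, and no proper `Γ`-invariant group of vectors contains that plane. -/
theorem map_transl_right {α : G →* G}
    (hα : ∀ g, g • basePlane = basePlane → α g • basePlane = basePlane) (v : V) :
    (α (transl v)).right = 1 := by
  let H : Subgroup G := (SemidirectProduct.rightHom.comp α).ker
  have hT : translVectors H = ⊤ := by
    refine addSubgroup_eq_top_of_plane (fun γ v hv => ?_) fun v hv => ?_
    · rw [mem_translVectors] at hv ⊢
      rw [← rot_conj_transl]
      exact (MonoidHom.normal_ker (SemidirectProduct.rightHom.comp α)).conj_mem _ hv _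
    · rw [mem_translVectors, transl_eq_commutator hv]
      have h1 := rot_right_smul_of_smul_basePlane (hα _ (transl_smul_basePlane
        (v := (1 / 2 : ℝ) • v) (by simp [hv])))
      have h2 := rot_right_smul_of_smul_basePlane (hα _ rot_halfTurn_smul)
      refine MonoidHom.mem_ker.2 ?_
      simp only [map_mul, map_inv]
      rw [mul_inv_eq_one, mul_inv_eq_iff_eq_mul]
      exact stabilizer_comm h1 h2
  exact MonoidHom.mem_ker.1 (mem_translVectors.1 (hT ▸ AddSubgroup.mem_top v))

theorem eq_polarLine_of_isomorphic_basePlane {W : Submodule ℝ V} (hW : IsTransversal W)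
    (h : LoopTheory.Isomorphic (loopMul (theta basePlane W) basePlane)
      (loopMul (theta basePlane (polarLine basePlane)) basePlane)) : W = polarLine basePlane := by
  obtain ⟨f, hf⟩ := h
  have hP : (0 : V) ∈ basePlane.1 := (zero_mem_iff _).2 basePlane_normal.2
  have hΘ := isSharplyTransitive_theta hP hW
  have hΘ' := isSharplyTransitive_theta hP (isTransversal_polarLine basePlane)
  obtain ⟨α, hα, hαΘ⟩ := exists_hom_of_isIsomorphism hΘ hΘ' (closure_theta hP hW) hf
  -- A loop isomorphism preserves the identity.
  have hfix : f basePlane = basePlane := by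
    have hL := hΘ'.isLoop (one_mem_theta hP _) basePlane
    have h1 := hf basePlane basePlane
    rw [(hΘ.isLoop (one_mem_theta hP _) basePlane).one_mul] at h1
    exact (hL.existsUnique_left (f basePlane) (f basePlane)).unique h1.symm (hL.mul_one _)
  have hstab : ∀ g, g • basePlane = basePlane → α g • basePlane = basePlane := fun g hg => by
    have := hα g basePlane
    rw [hg, hfix] at this
    exact this.symm
  have hinj : Function.Injective α := fun g g' hgg => smul_faithful fun X =>
    f.injective (by rw [hα, hα, hgg])
  obtain ⟨w, rfl, hw⟩ := exists_eq_span_of_isTransversal hW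
  have hwΘ := hαΘ _ (transl_mem_theta (Submodule.mem_span_singleton_self w))
  obtain ⟨l, hl, δ, -, e⟩ := mem_theta_basePlane.1 hwΘ
  have hδ : δ = 1 := by
    rw [← mot_right l δ, ← e]
    exact map_transl_right hstab w
  rw [hδ, ← transl_eq] at e
  have hk := rot_right_smul_of_smul_basePlane (hstab _ rot_halfTurn_smul)
  rw [rot_smul_basePlane] at hk
  -- The image of the half turn stabilizes the base plane, so its rotation part fixes the axis on
  -- which `l` lies.
  have hkl : ad (α (rot halfTurn)).right l = l := by
    obtain ⟨c, rfl⟩ := mem_polarLine.1 hl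
    rw [map_smul, basePlane_normal.1, hk]
  -- Conjugating the translation by `l` with the image of the half turn gives the translation by its
  -- rotated vector, which is again `l`. Injectivity of `α` carries this back to `w`.
  have hconj : α (transl (ad halfTurn w)) = α (transl w) := by
    rw [← rot_conj_transl, map_mul, map_mul, map_inv, e, mul_inv_eq_iff_eq_mul,
      ← mot_eta (α (rot halfTurn)), transl_eq, mot_mul, mot_mul, hkl, mot_inj]
    simp [add_comm]
  have hww : ad halfTurn w = w := by
    have := hinj hconj
    rw [transl_eq, transl_eq, mot_inj] at this
    exact this.1
  rw [ad_halfTurn] at hww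
  have h0 := congrFun hww 0
  have h1 := congrFun hww 1
  simp at h0 h1
  have hwe : w = w 2 • normal basePlane := by
    rw [basePlane_normal.1]
    ext i
    fin_cases i <;> simp <;> linarith
  rw [polarLine_eq_span, hwe, Submodule.span_singleton_smul_eq (isUnit_iff_ne_zero.2 hw)]

/-- Conjugation by `γ` is an isomorphism of loops. -/
theorem isIsomorphism_rot {P : Psi} (hP : (0 : V) ∈ P.1) {W : Submodule ℝ V}
    (hW : IsTransversal W) (γ : PSL2) :
    LoopTheory.IsIsomorphism (loopMul (theta P W) P)
      (loopMul (theta (rot γ • P) (W.map (ad γ).toLinearMap)) (rot γ • P))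
      (MulAction.toPerm (rot γ)) := fun X Y =>
  loopMul_smul (isSharplyTransitive_theta hP hW) (isSharplyTransitive_theta
    ((zero_mem_iff _).2 ((height_rot_smul γ P).trans ((zero_mem_iff P).1 hP)))
    (isTransversal_map hW γ)) (fun _ => conj_mem_theta γ) P X Y

theorem isomorphic_symm {L L' : Type*} {mul : L → L → L} {mul' : L' → L' → L'}
    (h : LoopTheory.Isomorphic mul mul') : LoopTheory.Isomorphic mul' mul := by
  obtain ⟨f, hf⟩ := h
  exact ⟨f.symm, fun x y => by rw [Equiv.symm_apply_eq, hf, f.apply_symm_apply, f.apply_symm_apply]⟩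

theorem isomorphic_trans {L L' L'' : Type*} {mul : L → L → L} {mul' : L' → L' → L'}
    {mul'' : L'' → L'' → L''} (h : LoopTheory.Isomorphic mul mul')
    (h' : LoopTheory.Isomorphic mul' mul'') : LoopTheory.Isomorphic mul mul'' := by
  obtain ⟨f, hf⟩ := h
  obtain ⟨f', hf'⟩ := h'
  exact ⟨f.trans f', fun x y => by
    rw [Equiv.trans_apply, hf, hf', Equiv.trans_apply, Equiv.trans_apply]⟩

theorem eq_polarLine_of_isomorphic {P : Psi} (hP : (0 : V) ∈ P.1) {W : Submodule ℝ V}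
    (hW : IsTransversal W) (h : LoopTheory.Isomorphic (loopMul (theta P W) P)
      (loopMul (theta P (polarLine P)) P)) : W = polarLine P := by
  obtain ⟨γ, W', rfl, hW', rfl, -⟩ := exists_theta_conj hP hW
  have hB : (0 : V) ∈ basePlane.1 := (zero_mem_iff _).2 basePlane_normal.2
  have h1 := isIsomorphism_rot hB hW' γ
  have h2 := isIsomorphism_rot hB (isTransversal_polarLine basePlane) γ
  rw [polarLine_rot_smul] at h ⊢
  rw [eq_polarLine_of_isomorphic_basePlane hW'
    (isomorphic_trans ⟨_, h1⟩ (isomorphic_trans h (isomorphic_symm ⟨_, h2⟩)))]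

/-- The line `polarLine P` moves along with `P`, so an element fixing `P` normalizes the whole
section and acts by automorphisms. The circle itself is the rotation group about the third axis,
conjugated by an element carrying the base plane to `P`. -/
theorem exists_circle_action {P : Psi} (hP : (0 : V) ∈ P.1) :
    ∃ κ : Circle →* Equiv.Perm Psi, Function.Injective κ ∧
      ContMDiff ((𝓡 1).prod (𝓡 3)) (𝓡 3) ∞ (fun q : Circle × Psi => κ q.1 q.2) ∧
      Set.range κ = {f | ∃ γ : PSL2, rot γ • P = P ∧ ∀ X, f X = rot γ • X} ∧
      ∀ k, LoopTheory.IsIsomorphism (loopMul (theta P (polarLine P)) P)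
        (loopMul (theta P (polarLine P)) P) (κ k) := by
  obtain ⟨γ, rfl⟩ := exists_rot_basePlane hP
  let r : Circle →* PSL2 := (MulAut.conj γ).toMonoidHom.comp rotC
  have hr : ∀ z, r z = γ * rotC z * γ⁻¹ := fun z => rfl
  have hfix : ∀ z, rot (r z) • rot γ • basePlane = rot γ • basePlane := fun z => by
    rw [← mul_smul, ← rot_mul, hr, inv_mul_cancel_right, rot_mul, mul_smul, rotC_smul_basePlane]
  refine ⟨(MulAction.toPermHom G Psi).comp (SemidirectProduct.inr.comp r), ?_, ?_, ?_, ?_⟩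
  · intro z w h
    have h1 : rot (r z) = rot (r w) := smul_faithful fun X => DFunLike.congr_fun h X
    exact rotC_injective ((MulAut.conj γ).injective (SemidirectProduct.inr_injective h1))
  · have h1 := contMDiff_smul (rot γ) (contMDiff_rotC_smul.comp
      ((contMDiff_fst (I := 𝓡 1) (J := 𝓡 3) (M := Circle) (N := Psi) (n := ∞)).prodMk
        (contMDiff_smul (rot γ⁻¹) (contMDiff_snd (I := 𝓡 1) (J := 𝓡 3)))))
    refine h1.congr fun q => ?_
    change rot (r q.1) • q.2 = rot γ • rot (rotC q.1) • rot γ⁻¹ • q.2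
    rw [hr, rot_mul, rot_mul, mul_smul, mul_smul]
  · ext f
    constructor
    · rintro ⟨z, rfl⟩
      exact ⟨r z, hfix z, fun X => rfl⟩
    · rintro ⟨δ, hδ, hf⟩
      obtain ⟨z, hz⟩ := exists_rotC_of_stabilizer (γ := γ⁻¹ * δ * γ) (by
        rw [rot_mul, rot_mul, mul_smul, mul_smul, hδ, rot_inv, inv_smul_smul])
      refine ⟨z, Equiv.ext fun X => ?_⟩
      rw [hf]
      change rot (r z) • X = _
      rw [hr, hz]
      congr 2
      group
  · intro z
    have := isIsomorphism_rot hP (isTransversal_polarLine (rot γ • basePlane)) (r z)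
    rwa [← polarLine_rot_smul, hfix] at this

end PseudoEuclid

theorem mainTheorem7 (P : Psi) (hP : (0 : V) ∈ P.1) :
    -- every admissible `Λ` gives a differentiable loop with left translation group `G`, never Bol
    (∀ W : Submodule ℝ V, IsTransversal W →
      (∀ D₁ D₂ : Psi, ∃! ρ : G, ρ ∈ theta P W ∧ ρ • D₁ = D₂) ∧
      ∀ Q : Psi,
        IsDifferentiableLoop (𝓡 3) (loopMul (theta P W) Q) Q ∧
        (∃ Φ : G →* (Psi ≃ₜ Psi), Function.Injective Φ ∧ (∀ g X, Φ g X = g • X) ∧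
          leftTranslations (loopMul (theta P W) Q) = Φ '' theta P W ∧
          Subgroup.closure (leftTranslations (loopMul (theta P W) Q)) = Φ.range ∧
          topologicallyGenerated (leftTranslations (loopMul (theta P W) Q)) = Set.range Φ) ∧
        ¬ IsBol (loopMul (theta P W) Q)) ∧
    -- the polar line of `P` is admissible, and `K` is a compact group of automorphisms of its loop
    IsTransversal (polarLine P) ∧
    (∃ κ : Circle →* Equiv.Perm Psi, Function.Injective κ ∧
      ContMDiff ((𝓡 1).prod (𝓡 3)) (𝓡 3) ∞ (fun q : Circle × Psi => κ q.1 q.2) ∧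
      Set.range κ = {f | ∃ γ : PSL2, rot γ • P = P ∧ ∀ X, f X = rot γ • X} ∧
      ∀ k, IsIsomorphism (loopMul (theta P (polarLine P)) P)
        (loopMul (theta P (polarLine P)) P) (κ k)) ∧
    -- every other line gives a loop that is not isomorphic to it
    (∀ W : Submodule ℝ V, IsTransversal W → W ≠ polarLine P →
      ¬ Isomorphic (loopMul (theta P W) P) (loopMul (theta P (polarLine P)) P)) ∧
    -- lines conjugate under `K` give isomorphic loops
    (∀ W : Submodule ℝ V, IsTransversal W → ∀ γ : PSL2, rot γ • P = P →
      IsTransversal (W.map (ad γ).toLinearMap) ∧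
      Isomorphic (loopMul (theta P (W.map (ad γ).toLinearMap)) P) (loopMul (theta P W) P)) := by
  refine ⟨fun W hW => ⟨isSharplyTransitive_theta hP hW, fun Q => ?_⟩, isTransversal_polarLine P,
    exists_circle_action hP, fun W hW hne h => hne (eq_polarLine_of_isomorphic hP hW h),
    fun W hW γ hγ => ⟨isTransversal_map hW γ, ?_⟩⟩
  · have hΘ := isSharplyTransitive_theta hP hW
    have hc := closure_theta hP hW
    exact ⟨hΘ.isDifferentiableLoop (one_mem_theta hP W) (isSmoothSection_theta hP hW) Q,
      ⟨actHom, actHom_injective, fun g X => rfl, leftTranslations_loopMul hΘ Q,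
        closure_leftTranslations hΘ hc Q, topologicallyGenerated_leftTranslations hΘ hc Q⟩,
      not_isBol hP hW Q⟩
  · have h := isIsomorphism_rot hP hW γ
    rw [hγ] at h
    exact isomorphic_symm ⟨_, h⟩
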